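/- **Setting.** Fix an integer $l\ge 1$ and a scalar quantizer $Q:\mathbb R\to\{q_0,\dots,q_l\}$ with $l+1$ (measurable) decision cells and $Q(0)=q_0$. An ensemble of $n$ random sequences $s_m[i]$, $1\le m\le n$, $1\le i\le T$, with finite second moments and an arbitrary joint law, is jointly sparse in one of two senses: * *overall sparsity*: almost surely at most $k$ of the $nT$ samples are non-zero ($1\le k\le nT$); put $\vartheta=\binom{nT}{k}$ and $\mathcal I(k)=\{1,\dots,k\}$; * *structured sparsity*: almost surely at most $k_s$ of the $n$ sequences are non-zero, and there are at most $k_t$ time instants at which some sequence is non-zero ($1\le k_s\le n$, $1\le k_t\le T$); put $k=k_sk_t$, $\vartheta=\binom{n}{k_s}\binom{T}{k_t}$ and $\mathcal I(k)=\{u_tu_s:1\le u_t\le k_t,\ 1\le u_s\le k_s\}$. **The scheme (distributed SQuaTS).** A random codebook, independent of the signals, holds for each pair $(m,i)$ a bin of $l$ words $c_{1,m,i},\dots,c_{l,m,i}\in\{0,1\}^b$, all $nTlb$ bits being independent and equal to $1$ with probability $\ln 2/k$; the all-zero word $c_0$ is added to each bin as word number $0$. Encoder $m$ starts with the all-zero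 register, and at time $i$ replaces it by its Boolean OR with word number $j$ of bin $(m,i)$, where $q_j=Q(s_m[i])$. The $n$ final registers are conveyed over a finite acyclic network in which every node outputs the OR of its inputs on its intact links and every encoder has an intact path to the decoder (a single-hop network is a special case); the decoder takes the OR $\mathbf y\in\{0,1\}^b$ of the words that it receives. Knowing the codebook, the maximum likelihood (ML) decoder chooses, among all selections of one word from each bin of a set $\mathcal X$ of $k$ bins, one that maximizes the conditional probability of $\mathbf y$ given the selected words (ties are broken arbitrarily); here $\mathcal X$ runs over all sets of $k$ pairs $(m,i)$ under overall sparsity, and over all products of a set of $k_s$ sequences with a set of $k_t$ time instants under structured sparsity. It outputs $\hat s_m[i]=q_j$ if word number $j$ of bin $(m,i)\in\mathcal X$ was selected, and $\hat s_m[i]=q_0$ if $(m,i)\notin\mathcal X$. (If the set of pairs with a non-zero quantization index is almost surely equal to one of the sets $\mathcal X$, the decoder may also be restricted to the words number $1,\dots,l$.) The quantization rate is $R=b/(nT)$, the MSE is $\sum_i\sum_m\mathbb E[(s_m[i]-\hat s_m[i])^2]$, the expectation being over signals and codebook, and $D_{T,n}(l)=\sum_i\sum_m\mathbb E[(s_m[i]-Q(s_m[i]))^2]$.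 **Proposition.** Let $\varepsilon>0$ be fixed, and consider any sequence of such systems, with $l$ and $Q$ fixed, such that $nT\to\infty$, $k=\mathcal O(1)$ and $$R\;\ge\;\max_{u\in\mathcal I(k)}\frac{(1+\varepsilon)\,k}{u\,nT}\,\log_2\!\left(\vartheta\, l^{\,u}\right).$$ If $k=1$ occurs, assume in addition that $\varepsilon>\frac{1}{\ln 2\,\log_2(1/\ln 2)}-1$. Then the probability that $\hat s_m[i]\ne Q(s_m[i])$ for some $(m,i)$ tends to $0$; and if the total energies $\sum_i\sum_m\mathbb E[s_m[i]^2]$ are bounded along the sequence, then the MSE achieves $D_{T,n}(l)$, that is, the difference of the MSE and $D_{T,n}(l)$ tends to $0$. -/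

import Mathlib

open MeasureTheory Filter Topology

namespace SQuaTS

/-- Binary words of `b` bits. The order is the pointwise one on `Bool`, so `⊔` (and `Finset.sup`) is
the bitwise Boolean OR and `⊥` is the all-zero word. -/
abbrev Word (b : ℕ) : Type := Fin b → Bool

/-! ### Scalar quantizers -/

/-- A scalar quantization mapping on `ℝ` with `l + 1` output levels, split into the map that sends
a sample to the index of its cell and the output level of each cell. -/
structure ScalarQuantizer (l : ℕ) where
  /-- index of the cell of a sample -/
  index : ℝ → Fin (l + 1)
  /-- the output values `q_0, …, q_l` -/
  level : Fin (l + 1) → ℝ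
  measurable_index : Measurable index
  /-- the input `0` is mapped to `q_0` -/
  index_zero : index 0 = 0

/-- The quantizer output `Q(x)`. -/
def ScalarQuantizer.quantize {l : ℕ} (Q : ScalarQuantizer l) (x : ℝ) : ℝ := Q.level (Q.index x)

/-! ### Joint sparsity of `n` sequences of length `T` -/

/-- The two joint sparsity models. -/
inductive JointSparsity where
  /-- at most `k` non-zero samples in the whole ensemble -/
  | overall (k : ℕ)
  /-- at most `kₜ` active time instants and at most `kₛ` active sequences -/
  | structured (kₜ kₛ : ℕ)

namespace JointSparsity

/-- The joint support size `k`. -/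
def size : JointSparsity → ℕ
  | overall k => k
  | structured kₜ kₛ => kₛ * kₜ

/-- The sparsity parameters are positive and not larger than the dimensions. -/
def Admissible (n T : ℕ) : JointSparsity → Prop
  | overall k => 1 ≤ k ∧ k ≤ n * T
  | structured kₜ kₛ => (1 ≤ kₜ ∧ kₜ ≤ T) ∧ (1 ≤ kₛ ∧ kₛ ≤ n)

/-- The sparsity constraint on an ensemble `x m i` (sequence `m`, time `i`). -/
def IsSparse {n T : ℕ} : JointSparsity → (Fin n → Fin T → ℝ) → Prop
  | overall k, x => {e : Fin n × Fin T | x e.1 e.2 ≠ 0}.ncard ≤ k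
  | structured kₜ kₛ, x =>
      {i : Fin T | ∃ m, x m i ≠ 0}.ncard ≤ kₜ ∧ {m : Fin n | ∃ i, x m i ≠ 0}.ncard ≤ kₛ

/-- The candidate sets of `k` bins which the decoder scans. -/
def supports (n T : ℕ) : JointSparsity → Set (Finset (Fin n × Fin T))
  | overall k => {X | X.card = k}
  | structured kₜ kₛ => {X | ∃ (A : Finset (Fin n)) (B : Finset (Fin T)),
      A.card = kₛ ∧ B.card = kₜ ∧ X = A ×ˢ B}

/-- The parameter `ϑ`. -/
def theta (n T : ℕ) : JointSparsity → ℕ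
  | overall k => (n * T).choose k
  | structured kₜ kₛ => n.choose kₛ * T.choose kₜ

/-- The index set `I(k)`. -/
def indexSet : JointSparsity → Finset ℕ
  | overall k => Finset.Icc 1 k
  | structured kₜ kₛ => Finset.image₂ (fun uₜ uₛ => uₜ * uₛ) (Finset.Icc 1 kₜ) (Finset.Icc 1 kₛ)

end JointSparsity

/-! ### Rate -/

/-- The quantization rate `R = b / (n T)`. -/
noncomputable def rate (n T b : ℕ) : ℝ := (b : ℝ) / ((n : ℝ) * (T : ℝ))

/-- `max_{u ∈ I(k)} (1 + ε) k / (u n T) · log₂ (ϑ lᵘ)`. -/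
noncomputable def rateThreshold (ε : ℝ) (l n T : ℕ) (σ : JointSparsity) : ℝ :=
  ⨆ u : σ.indexSet, (1 + ε) * (σ.size : ℝ) / ((u : ℕ) * ((n : ℝ) * (T : ℝ))) *
    Real.logb 2 ((σ.theta n T : ℝ) * (l : ℝ) ^ (u : ℕ))

/-! ### Codebook -/

/-- The bits of the `n T l` random codewords: for each bin `(m, i)` and each `j : Fin l`, a word of
`b` bits. -/
abbrev Codebook (n T l b : ℕ) : Type := Fin n × Fin T × Fin l × Fin b → Bool

/-- The word number `j ∈ {0, …, l}` of the bin of sequence `m` and time `i`; the word number `0` of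
every bin is the all-zero word. -/
def codeword {n T l b : ℕ} (C : Codebook n T l b) (m : Fin n) (i : Fin T) (j : Fin (l + 1)) :
    Word b :=
  Fin.cases (motive := fun _ => Word b) ⊥ (fun j' t => C (m, i, j', t)) j

/-- The number `ln 2 / k`, as an element of the unit interval. -/
noncomputable def bitMean (k : ℕ) : unitInterval :=
  ⟨Real.log 2 / k, div_nonneg (Real.log_nonneg (by norm_num)) (by positivity), by
    rcases Nat.eq_zero_or_pos k with rfl | hk
    · simp
    · have : (1 : ℝ) ≤ k := by exact_mod_cast hk
      rw [div_le_one (by linarith)]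
      linarith [Real.log_two_lt_d9]⟩

/-- The law of the codebook: all bits are independent, and each is `1` with probability
`ln 2 / k`. -/
noncomputable def codebookLaw (n T l b k : ℕ) : Measure (Codebook n T l b) :=
  Measure.pi fun _ => ProbabilityTheory.bernoulliMeasure true false (bitMean k)

instance codebookLaw_isProbabilityMeasure (n T l b k : ℕ) :
    IsProbabilityMeasure (codebookLaw n T l b k) := by
  unfold codebookLaw; infer_instance

/-! ### Encoders -/

/-- The encoder of sequence `m`: a register of `b` bits, initially all-zero, is updated at the times
`0, …, T - 1` by OR with the word of the current bin selected by the index of `Q(x i)`. -/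
def encode {n T l b : ℕ} (Q : ScalarQuantizer l) (C : Codebook n T l b) (m : Fin n)
    (x : Fin T → ℝ) : Word b :=
  Fin.foldl T (fun y i => y ⊔ codeword C m i (Q.index (x i))) ⊥

theorem encode_eq_sup {n T l b : ℕ} (Q : ScalarQuantizer l) (C : Codebook n T l b) (m : Fin n)
    (x : Fin T → ℝ) :
    encode Q C m x = Finset.univ.sup fun i => codeword C m i (Q.index (x i)) := by
  have key : ∀ (N : ℕ) (f : Fin N → Word b),
      Fin.foldl N (fun y i => y ⊔ f i) ⊥ = Finset.univ.sup f := by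
    intro N
    induction N with
    | zero => intro f; simp
    | succ N ih =>
      intro f
      rw [Fin.foldl_succ_last, ih]
      apply le_antisymm
      · refine sup_le (Finset.sup_le fun i _ => ?_) (Finset.le_sup (Finset.mem_univ _))
        exact Finset.le_sup (f := f) (Finset.mem_univ _)
      · refine Finset.sup_le fun i _ => ?_
        induction i using Fin.lastCases with
        | last => exact le_sup_right
        | cast i =>
          exact le_sup_of_le_left
            (Finset.le_sup (f := fun i : Fin N => f i.castSucc) (Finset.mem_univ i))
  exact key T _

/-! ### The network between the encoders and the decoder -/

/-- A directed acyclic network. Only the intact links are recorded; broken links carry nothing. From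
each encoder at least one intact path leads to the decoder. A single-hop network has no inner links
and every encoder node is linked to the decoder. -/
structure RelayNetwork (n : ℕ) where
  numNodes : ℕ
  /-- the node at which the `m`-th encoder is located -/
  encoderNode : Fin n → Fin numNodes
  /-- `link v w`: there is an intact link from `v` to `w` -/
  link : Fin numNodes → Fin numNodes → Prop
  /-- the nodes with an intact link to the decoder -/
  lastNodes : Finset (Fin numNodes)
  acyclic : ∀ v, ¬ Relation.TransGen link v v
  connected : ∀ m, ∃ v ∈ lastNodes, Relation.ReflTransGen link (encoderNode m) v

namespace RelayNetwork

theorem wellFounded_link {n : ℕ} (N : RelayNetwork n) : WellFounded N.link := by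
  have : IsTrans (Fin N.numNodes) (Relation.TransGen N.link) := inferInstance
  have : Std.Irrefl (Relation.TransGen N.link) := ⟨N.acyclic⟩
  exact Subrelation.wf (fun h => Relation.TransGen.single h)
    (Finite.wellFounded_of_trans_of_irrefl (Relation.TransGen N.link))

open Classical in
/-- The output of a node: the OR of the words of the encoders located at the node and of the outputs
of all nodes with an intact link to it. -/
noncomputable def nodeOutput {n b : ℕ} (N : RelayNetwork n) (x : Fin n → Word b) :
    Fin N.numNodes → Word b :=
  N.wellFounded_link.fix fun v out =>
    (Finset.univ.filter fun m => N.encoderNode m = v).sup x ⊔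
      (Finset.univ : Finset {w // N.link w v}).sup fun w => out w.1 w.2

open Classical in
theorem nodeOutput_eq {n b : ℕ} (N : RelayNetwork n) (x : Fin n → Word b) (v : Fin N.numNodes) :
    N.nodeOutput x v =
      (Finset.univ.filter fun m => N.encoderNode m = v).sup x ⊔
        (Finset.univ.filter fun w => N.link w v).sup (N.nodeOutput x) := by
  unfold nodeOutput
  rw [WellFounded.fix_eq]
  congr 1
  apply le_antisymm
  · refine Finset.sup_le fun w _ => ?_
    exact Finset.le_sup (f := N.wellFounded_link.fix _) (by simpa using w.2)
  · refine Finset.sup_le fun w hw => ?_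
    exact Finset.le_sup
      (f := fun w : {w // N.link w v} => N.wellFounded_link.fix (C := fun _ => Word b) _ w.1)
      (Finset.mem_univ (⟨w, by simpa using hw⟩ : {w // N.link w v}))

/-- The word collected by the decoder: the OR of the outputs of the last nodes. -/
noncomputable def received {n b : ℕ} (N : RelayNetwork n) (x : Fin n → Word b) : Word b :=
  N.lastNodes.sup (N.nodeOutput x)

end RelayNetwork

/-! ### Maximum likelihood decoding -/

/-- A set `X` of bins with the number of a word in each bin (only the numbers in the bins that
belong to `X` matter). -/
abbrev Selection (n T l : ℕ) : Type := Finset (Fin n × Fin T) × (Fin n → Fin T → Fin (l + 1))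

/-- The OR of the selected codewords. -/
noncomputable def superpose {n T l b : ℕ} (C : Codebook n T l b) (w : Selection n T l) : Word b :=
  w.1.sup fun e => codeword C e.1 e.2 (w.2 e.1 e.2)

/-- The conditional probability of the word `y` given the selected codewords (encoders and
network are noiseless, so the conditional law is a point mass). -/
noncomputable def likelihood {n T l b : ℕ} (C : Codebook n T l b) (y : Word b)
    (w : Selection n T l) : ENNReal :=
  PMF.pure (superpose C w) y

/-- The selections scanned by the decoder: one word, with number in `J`, from each bin of a
candidate set of bins. -/
def candidates (σ : JointSparsity) (n T : ℕ) {l : ℕ} (J : Set (Fin (l + 1))) :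
    Set (Selection n T l) :=
  {w | w.1 ∈ σ.supports n T ∧ ∀ e ∈ w.1, w.2 e.1 e.2 ∈ J}

/-- `dec` maps a codebook and a received word to a candidate of maximal likelihood (ties are broken
arbitrarily). -/
def IsMLDecoder (σ : JointSparsity) {n T l b : ℕ} (J : Set (Fin (l + 1)))
    (dec : Codebook n T l b → Word b → Selection n T l) : Prop :=
  ∀ C y, dec C y ∈ candidates σ n T J ∧
    ∀ w ∈ candidates σ n T J, likelihood C y w ≤ likelihood C y (dec C y)

open Classical in
/-- The digital representation given by a selection: `q_j` for the selected number `j` in the bins of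
`X`, and `q_0` elsewhere. -/
noncomputable def reconstruct {n T l : ℕ} (Q : ScalarQuantizer l) (w : Selection n T l) (m : Fin n)
    (i : Fin T) : ℝ :=
  if (m, i) ∈ w.1 then Q.level (w.2 m i) else Q.level 0

/-- The output of the whole system for the ensemble `x`. -/
noncomputable def output {n T l b : ℕ} (Q : ScalarQuantizer l) (N : RelayNetwork n)
    (dec : Codebook n T l b → Word b → Selection n T l) (C : Codebook n T l b)
    (x : Fin n → Fin T → ℝ) : Fin n → Fin T → ℝ :=
  reconstruct Q (dec C (N.received fun m => encode Q C m (x m)))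

/-! ### Performance. The codebook is random and independent of the signals. -/

section Performance

variable {Ω : Type*} [MeasurableSpace Ω]

/-- The probability that some `ŝ_m[i]` differs from `Q(s_m[i])`. -/
noncomputable def errorProb (P : Measure Ω) {n T l b : ℕ} (k : ℕ) (Q : ScalarQuantizer l)
    (N : RelayNetwork n) (dec : Codebook n T l b → Word b → Selection n T l)
    (s : Ω → Fin n → Fin T → ℝ) : ℝ :=
  (P.prod (codebookLaw n T l b k)).real
    {z | ∃ m i, output Q N dec z.2 (s z.1) m i ≠ Q.quantize (s z.1 m i)}

/-- The MSE `∑_i ∑_m E[(s_m[i] - ŝ_m[i])²]` of the system. -/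
noncomputable def mse (P : Measure Ω) {n T l b : ℕ} (k : ℕ) (Q : ScalarQuantizer l)
    (N : RelayNetwork n) (dec : Codebook n T l b → Word b → Selection n T l)
    (s : Ω → Fin n → Fin T → ℝ) : ℝ :=
  ∑ i, ∑ m, ∫ z, (s z.1 m i - output Q N dec z.2 (s z.1) m i) ^ 2
    ∂(P.prod (codebookLaw n T l b k))

/-- The MSE `D_{T,n}(l)` of `ŝ_m[i] = Q(s_m[i])`. -/
noncomputable def quantizerMSE (P : Measure Ω) {n T l : ℕ} (Q : ScalarQuantizer l)
    (s : Ω → Fin n → Fin T → ℝ) : ℝ :=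
  ∑ i, ∑ m, ∫ ω, (s ω m i - Q.quantize (s ω m i)) ^ 2 ∂P

/-- The total energy `∑_i ∑_m E[s_m[i]²]`. -/
noncomputable def energy (P : Measure Ω) {n T : ℕ} (s : Ω → Fin n → Fin T → ℝ) : ℝ :=
  ∑ i, ∑ m, ∫ ω, (s ω m i) ^ 2 ∂P

end Performance

end SQuaTS

namespace SQuaTS

/-! ### Estimates for powers of `q = 1 - ln 2 / k` -/

/-! Encoders and network together compute the OR of all words selected by the true indices `g`.
Since likelihoods are 0 or 1, the ML output has the same OR as `g`, so an error requires a feasible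
`f ≠ g` with the same OR. Everything rests on a union bound over such `f`.

Let `f` and `g` share `a` words and have `u` and `v` further ones. The `b` bit positions are
independent, so the two ORs agree with probability `(1 - δ) ^ b`, where `δ = mismatch k a u v`. The
rate condition, used only at `u = 1` and without its factor `l`, turns this into at most `ϑ ^ (-γ)`
with `γ = (1 + ε) k δ / ln 2`. Overall sparsity is treated as a grid with one column, so `ϑ` is
always a product of a row and a column binomial coefficient.

The heart is `add_min_le_mul_mismatch`: if `f` uses `r` rows not used by `g`, then `γ ks ≥ r + η`
with `η = min ε (1/4)`, and likewise for the `c` new columns with `kt`. As `choose N ks ≥ (N / ks) ^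
ks`, the pairwise probability is at most a constant times `N ^ (-r - η) M ^ (-c - η)` on an `N × M`
grid. The factors `N ^ (-r)` and `M ^ (-c)` pay for choosing the new rows and columns, and the word
numbers cost a bounded factor because `k` is bounded. The error probability is thus at most a
constant times `(n T) ^ (-η)`, uniformly in the signals.

For the MSE, an error changes the squared loss by at most a function of the signals alone, since at
most `2 k` samples are affected. Independence of codebook and signals lets the error probability
multiply the mean of that function, which is bounded when the energy is. -/

theorem mul_pow_le_one_sub_pow {q : ℝ} (h0 : 0 ≤ q) (h1 : q ≤ 1) (r : ℕ) :
    r * (1 - q) * q ^ (r - 1) ≤ 1 - q ^ r := by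
  have hsum : (1 - q) * ∑ i ∈ Finset.range r, q ^ i = 1 - q ^ r := mul_neg_geom_sum q r
  rw [← hsum, mul_comm (r : ℝ), mul_assoc]
  refine mul_le_mul_of_nonneg_left ?_ (by linarith)
  calc (r : ℝ) * q ^ (r - 1) = ∑ _i ∈ Finset.range r, q ^ (r - 1) := by simp
    _ ≤ _ := Finset.sum_le_sum fun i hi => by
        have := Finset.mem_range.1 hi
        exact pow_le_pow_of_le_one h0 h1 (by omega)

/-- Concavity: the increments of `m ↦ 1 - q ^ m` decrease, so its mean slope from 0 decreases too.
-/
theorem mul_one_sub_pow_le {q : ℝ} (h0 : 0 ≤ q) (h1 : q ≤ 1) {m k : ℕ} (hmk : m ≤ k) :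
    m * (1 - q ^ k) ≤ k * (1 - q ^ m) := by
  induction k, hmk using Nat.le_induction with
  | base => exact le_rfl
  | succ k hmk ih =>
    have h2 := mul_pow_le_one_sub_pow h0 h1 m
    have h3 : q ^ k ≤ q ^ (m - 1) := pow_le_pow_of_le_one h0 h1 (by omega)
    have h4 : (m : ℝ) * (1 - q) * q ^ k ≤ m * (1 - q) * q ^ (m - 1) :=
      mul_le_mul_of_nonneg_left h3 (mul_nonneg (Nat.cast_nonneg m) (by linarith))
    push_cast
    rw [pow_succ]
    nlinarith

theorem log_two_div_le_one (k : ℕ) : Real.log 2 / k ≤ 1 := (bitMean k).2.2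

theorem one_sub_log_two_le_pow {k : ℕ} (hk : 1 ≤ k) :
    1 - Real.log 2 ≤ (1 - Real.log 2 / k) ^ k := by
  have hk' : (k : ℝ) ≠ 0 := by positivity
  have h := one_add_mul_le_pow (a := -(Real.log 2 / k)) (by linarith [log_two_div_le_one k]) k
  have : (k : ℝ) * -(Real.log 2 / k) = - Real.log 2 := by field_simp
  rw [this] at h
  simpa [sub_eq_add_neg] using h

theorem pow_le_half {k : ℕ} (hk : 1 ≤ k) : (1 - Real.log 2 / k) ^ k ≤ 1 / 2 := by
  have hk' : (k : ℝ) ≠ 0 := by positivity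
  calc (1 - Real.log 2 / k) ^ k ≤ (Real.exp (-(Real.log 2 / k))) ^ k :=
        pow_le_pow_left₀ (by linarith [log_two_div_le_one k]) (Real.one_sub_le_exp_neg _) k
    _ = 1 / 2 := by
        rw [← Real.exp_nat_mul, show (k : ℝ) * -(Real.log 2 / k) = - Real.log 2 by field_simp,
          Real.exp_neg, Real.exp_log (by norm_num)]
        norm_num

/-- With `j = k - 1 ≥ 1`, `1 / q ≤ 1 + ln 2 / j ≤ exp (ln 2 / j)`, whose `j`-th power is 2. -/
theorem half_le_pow_pred {k : ℕ} (hk : 1 ≤ k) : 1 / 2 ≤ (1 - Real.log 2 / k) ^ (k - 1) := by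
  obtain ⟨j, rfl⟩ := Nat.exists_eq_add_of_le' hk
  have hl := Real.log_two_lt_d9
  have hl0 := Real.log_two_gt_d9
  rcases Nat.eq_zero_or_pos j with rfl | hj
  · norm_num
  have hj1 : (1 : ℝ) ≤ j := by exact_mod_cast hj
  simp only [add_tsub_cancel_right]
  set q : ℝ := 1 - Real.log 2 / ((j + 1 : ℕ) : ℝ) with hq
  have hjq : ((j + 1 : ℕ) : ℝ) = j + 1 := by push_cast; ring
  have hq0 : 0 < q := by
    rw [hq, hjq, sub_pos, div_lt_one (by positivity)]
    linarith
  have h1 : q⁻¹ ≤ Real.exp (Real.log 2 / j) := by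
    refine le_trans ?_ (Real.add_one_le_exp _)
    rw [inv_le_iff_one_le_mul₀ hq0, hq, hjq]
    have : (Real.log 2 / j + 1) * (1 - Real.log 2 / (j + 1)) =
        1 + Real.log 2 * (1 - Real.log 2) / (j * (j + 1)) := by
      field_simp
      ring
    rw [this]
    have : 0 ≤ Real.log 2 * (1 - Real.log 2) / (j * (j + 1)) :=
      div_nonneg (mul_nonneg (by linarith) (by linarith)) (by positivity)
    linarith
  have h2 : (q⁻¹) ^ j ≤ 2 := by
    calc (q⁻¹) ^ j ≤ (Real.exp (Real.log 2 / j)) ^ j := pow_le_pow_left₀ (by positivity) h1 j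
      _ = 2 := by
        rw [← Real.exp_nat_mul, mul_div_cancel₀ _ (by positivity), Real.exp_log (by norm_num)]
  rw [inv_pow, inv_le_iff_one_le_mul₀ (by positivity)] at h2
  linarith

/-! ### Lower bounds for the mismatch probability -/

/-- The probability that exactly one of the superpositions of two selections has a zero bit at a
given position, when the selections share `a` words and have `u` and `v` further words. -/
noncomputable def mismatch (k a u v : ℕ) : ℝ :=
  (1 - Real.log 2 / k) ^ (a + u) + (1 - Real.log 2 / k) ^ (a + v)
    - 2 * (1 - Real.log 2 / k) ^ (a + u + v)

/-- Serves the case without new rows. The mismatch is `q ^ (a+u) (1 - q ^ v) + q ^ (a+v) (1 - q ^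
u)`; one of the two terms is at least `q ^ k (1 - q)`, and `q ^ k ≥ 1 - ln 2` by Bernoulli. -/
theorem le_mismatch_of_ne_zero {k a u v : ℕ} (hk : 1 ≤ k) (hau : a + u ≤ k) (hav : a + v ≤ k)
    (huv : u ≠ 0 ∨ v ≠ 0) :
    (1 - Real.log 2) * (Real.log 2 / k) ≤ mismatch k a u v := by
  have hl := Real.log_two_lt_d9
  have hl0 := Real.log_two_gt_d9
  have hqk := one_sub_log_two_le_pow hk
  have hp0 : 0 ≤ Real.log 2 / k := (bitMean k).2.1
  have hp1 := log_two_div_le_one k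
  unfold mismatch
  set q := 1 - Real.log 2 / k with hq
  have hpq : Real.log 2 / k = 1 - q := by rw [hq]; ring
  rw [hpq] at hp0 hp1 ⊢
  have hq0 : 0 ≤ q := by linarith
  have hq1 : q ≤ 1 := by linarith
  have key : ∀ c d : ℕ, c ≤ k → d ≠ 0 → (1 - Real.log 2) * (1 - q) ≤ q ^ c * (1 - q ^ d) := by
    intro c d hc hd
    have h1 : q ^ k ≤ q ^ c := pow_le_pow_of_le_one hq0 hq1 hc
    have h2 : q ^ d ≤ q := pow_le_of_le_one hq0 hq1 hd
    exact mul_le_mul (by linarith) (by linarith) hp0 (by positivity)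
  have nn : ∀ c d : ℕ, 0 ≤ q ^ c * (1 - q ^ d) := fun c d =>
    mul_nonneg (by positivity) (by linarith [pow_le_one₀ hq0 hq1 (n := d)])
  have e : q ^ (a + u) + q ^ (a + v) - 2 * q ^ (a + u + v)
      = q ^ (a + u) * (1 - q ^ v) + q ^ (a + v) * (1 - q ^ u) := by ring
  rw [e]
  rcases huv with h | h
  · linarith [key (a + v) u hav h, nn (a + u) v]
  · linarith [key (a + u) v hau h, nn (a + v) u]

/-- For fixed `a` and `u` the mismatch is affine in `q ^ v`, which ranges over `[q ^ (k - a), 1]`.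
The two arguments of `min` are its values at the endpoints `v = 0` and `v = k - a`. -/
theorem min_le_mismatch {k a u v : ℕ} (hav : a + v ≤ k) :
    min ((1 - Real.log 2 / k) ^ a * (1 - (1 - Real.log 2 / k) ^ u))
      ((1 - Real.log 2 / k) ^ (a + u) * (1 - (1 - Real.log 2 / k) ^ (k - a))
        + (1 - Real.log 2 / k) ^ k * (1 - (1 - Real.log 2 / k) ^ u)) ≤ mismatch k a u v := by
  have hp0 : 0 ≤ Real.log 2 / k := (bitMean k).2.1
  have hp1 := log_two_div_le_one k
  unfold mismatch
  set q := 1 - Real.log 2 / k with hq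
  have hq0 : 0 ≤ q := by linarith
  have hq1 : q ≤ 1 := by linarith
  have e : q ^ (a + u) + q ^ (a + v) - 2 * q ^ (a + u + v)
      = q ^ a * (q ^ u + q ^ v * (1 - 2 * q ^ u)) := by ring
  have e2 : q ^ k = q ^ a * q ^ (k - a) := by rw [← pow_add]; congr 1; omega
  have ha : 0 ≤ q ^ a := by positivity
  have hv1 : q ^ v ≤ 1 := pow_le_one₀ hq0 hq1
  have hvk : q ^ (k - a) ≤ q ^ v := pow_le_pow_of_le_one hq0 hq1 (by omega)
  rw [e]
  rcases le_total 0 (1 - 2 * q ^ u) with h | h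
  · refine (min_le_right _ _).trans ?_
    rw [e2]
    calc _ = q ^ a * (q ^ u + q ^ (k - a) * (1 - 2 * q ^ u)) := by ring
      _ ≤ _ := by gcongr
  · refine (min_le_left _ _).trans ?_
    refine mul_le_mul_of_nonneg_left ?_ ha
    nlinarith

/-- The endpoint `v = 0`. Since `1 - q ^ u ≥ r (ln 2 / k) q ^ (r - 1)`, it remains to see that `ks *
q ^ (a + r - 1) ≥ 1`. The hypothesis `har` says that the shared words leave room for `r` full rows.
-/
theorem le_mismatch_left {k ks kt a u r : ℕ} (hks : 1 ≤ ks) (hkt : 1 ≤ kt) (hk : k = ks * kt)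
    (hr1 : 1 ≤ r) (hru : r ≤ u) (har : a + r * kt ≤ k) :
    r * Real.log 2 ≤ k * ks *
      ((1 - Real.log 2 / k) ^ a * (1 - (1 - Real.log 2 / k) ^ u)) := by
  have hk1 : 1 ≤ k := hk ▸ Nat.mul_pos hks hkt
  have hkR : (0 : ℝ) < k := by positivity
  have hp0 : 0 ≤ Real.log 2 / k := (bitMean k).2.1
  have hp1 := log_two_div_le_one k
  have hhalf := half_le_pow_pred hk1
  have hkp : k * (Real.log 2 / k) = Real.log 2 := by field_simp
  set q := 1 - Real.log 2 / k with hq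
  have hq0 : 0 ≤ q := by linarith
  have hq1 : q ≤ 1 := by linarith
  have h1 : r * (Real.log 2 / k) * q ^ (r - 1) ≤ 1 - q ^ u := by
    have := mul_pow_le_one_sub_pow hq0 hq1 r
    have h2 : q ^ u ≤ q ^ r := pow_le_pow_of_le_one hq0 hq1 hru
    have h3 : 1 - q = Real.log 2 / k := by rw [hq]; ring
    rw [h3] at this
    linarith
  have h2 : 1 ≤ ks * q ^ (a + (r - 1)) := by
    have hr' : r ≤ r * kt := Nat.le_mul_of_pos_right r hkt
    rcases Nat.lt_or_ge ks 2 with h | h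
    -- With a single row, `har` forces `r = 1` and `a = 0`; otherwise `ks ≥ 2` compensates `q ^ (k -
    -- 1) ≥ 1 / 2`.
    · have hks1 : ks = 1 := by omega
      subst hks1
      have hrk : r ≤ 1 := by
        by_contra hc
        have : 2 * kt ≤ r * kt := Nat.mul_le_mul_right _ (by omega)
        omega
      have : a + (r - 1) = 0 := by
        have : r = 1 := by omega
        subst this
        omega
      simp [this]
    · have : q ^ (k - 1) ≤ q ^ (a + (r - 1)) := pow_le_pow_of_le_one hq0 hq1 (by omega)
      have h2 : (2 : ℝ) ≤ ks := by exact_mod_cast h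
      nlinarith
  have hlog : 0 ≤ r * Real.log 2 := by
    have := Real.log_two_gt_d9
    positivity
  calc r * Real.log 2 ≤ r * Real.log 2 * (ks * q ^ (a + (r - 1))) := le_mul_of_one_le_right hlog h2
    _ = k * ks * (q ^ a * (r * (Real.log 2 / k) * q ^ (r - 1))) := by
        rw [pow_add]
        linear_combination (-(r : ℝ) * ks * q ^ a * q ^ (r - 1)) * hkp
    _ ≤ _ := by gcongr

/-- The endpoint `v = k - a`. Concavity gives `1 - q ^ (k - a)` and `1 - q ^ u` at least the
fractions `r kt / k` and `r / k` of `1 - q ^ k`; multiplied by `k ks`, these contribute `r k` and `r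
ks`. -/
theorem le_mismatch_right {k ks kt a u r : ℕ} (hks : 1 ≤ ks) (hkt : 1 ≤ kt) (hk : k = ks * kt)
    (hau : a + u ≤ k) (hru : r ≤ u) (har : a + r * kt ≤ k) :
    r * (k + ks) * ((1 - Real.log 2 / k) ^ k * (1 - (1 - Real.log 2 / k) ^ k)) ≤ k * ks *
      ((1 - Real.log 2 / k) ^ (a + u) * (1 - (1 - Real.log 2 / k) ^ (k - a))
        + (1 - Real.log 2 / k) ^ k * (1 - (1 - Real.log 2 / k) ^ u)) := by
  have hk1 : 1 ≤ k := hk ▸ Nat.mul_pos hks hkt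
  have hp0 : 0 ≤ Real.log 2 / k := (bitMean k).2.1
  have hp1 := log_two_div_le_one k
  set q := 1 - Real.log 2 / k with hq
  have hq0 : 0 ≤ q := by linarith
  have hq1 : q ≤ 1 := by linarith
  have h1 := mul_one_sub_pow_le hq0 hq1 (show k - a ≤ k by omega)
  have h2 := mul_one_sub_pow_le hq0 hq1 (show u ≤ k by omega)
  have h3 : ((r * kt : ℕ) : ℝ) ≤ (k - a : ℕ) := by exact_mod_cast (by omega)
  have h4 : (r : ℝ) ≤ u := by exact_mod_cast hru
  have hx : 0 ≤ 1 - q ^ k := by linarith [pow_le_one₀ hq0 hq1 (n := k)]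
  have h5 : ((r * kt : ℕ) : ℝ) * (1 - q ^ k) ≤ k * (1 - q ^ (k - a)) :=
    (mul_le_mul_of_nonneg_right h3 hx).trans h1
  have h6 : (r : ℝ) * (1 - q ^ k) ≤ k * (1 - q ^ u) :=
    (mul_le_mul_of_nonneg_right h4 hx).trans h2
  have h7 : q ^ k ≤ q ^ (a + u) := pow_le_pow_of_le_one hq0 hq1 hau
  have h8 : 0 ≤ 1 - q ^ (k - a) := by linarith [pow_le_one₀ hq0 hq1 (n := k - a)]
  have hkc : (k : ℝ) = ks * kt := by exact_mod_cast hk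
  push_cast at h5
  calc r * (k + ks) * (q ^ k * (1 - q ^ k))
      = ks * q ^ k * (r * kt * (1 - q ^ k) + r * (1 - q ^ k)) := by rw [hkc]; ring
    _ ≤ ks * q ^ k * (k * (1 - q ^ (k - a)) + k * (1 - q ^ u)) := by gcongr
    _ = k * ks * (q ^ k * (1 - q ^ (k - a)) + q ^ k * (1 - q ^ u)) := by ring
    _ ≤ _ := by gcongr

/-- Here `y = q ^ k` lies in `[1 - ln 2, 1/2]`, so `y (1 - y) > 0.2`, enough when `k + ks ≥ 4`. For
`k = 2` the exact value of `y` is needed. For `k = ks = 1` the inequality fails, whence the extra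
condition on `ε`. -/
theorem log_two_le_mul_pow_mul_one_sub_pow {k ks : ℕ} (hks : 1 ≤ ks) (hk : 2 ≤ k) :
    Real.log 2 ≤ (k + ks) * ((1 - Real.log 2 / k) ^ k * (1 - (1 - Real.log 2 / k) ^ k)) := by
  have hl := Real.log_two_lt_d9
  have hl0 := Real.log_two_gt_d9
  have h1 := one_sub_log_two_le_pow (k := k) (by omega)
  have h2 := pow_le_half (k := k) (by omega)
  have hs : (1 : ℝ) ≤ ks := by exact_mod_cast hks
  rcases Nat.lt_or_ge k 3 with h | h
  · have : k = 2 := by omega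
    subst this
    set x := Real.log 2 with hx
    have h3 : 0.4269 ≤ (1 - x / ((2 : ℕ) : ℝ)) ^ 2 := by push_cast; nlinarith
    set y := (1 - x / ((2 : ℕ) : ℝ)) ^ 2
    have h4 : 0.24 ≤ y * (1 - y) := by nlinarith
    push_cast
    nlinarith
  · have hk3 : (3 : ℝ) ≤ k := by exact_mod_cast h
    set y := (1 - Real.log 2 / (k : ℝ)) ^ k
    have h4 : 0.2 ≤ y * (1 - y) := by nlinarith
    nlinarith

/-- The exponent of the pairwise error bound exceeds the number of new rows, uniformly. -/
theorem add_min_le_mul_mismatch {k ks kt a u v r : ℕ} {ε : ℝ} (hε : 0 < ε)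
    (hks : 1 ≤ ks) (hkt : 1 ≤ kt) (hk : k = ks * kt) (hεk : k = 1 → 6 / 5 ≤ ε)
    (hau : a + u ≤ k) (hav : a + v ≤ k) (huv : u ≠ 0 ∨ v ≠ 0)
    (hru : r ≤ u) (har : a + r * kt ≤ k) :
    r + min ε (1 / 4) ≤ (1 + ε) * k * ks * mismatch k a u v / Real.log 2 := by
  have hl := Real.log_two_lt_d9
  have hl0 := Real.log_two_gt_d9
  have hk1 : 1 ≤ k := hk ▸ Nat.mul_pos hks hkt
  have hs : (1 : ℝ) ≤ ks := by exact_mod_cast hks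
  have hkR : (1 : ℝ) ≤ k := by exact_mod_cast hk1
  rw [le_div_iff₀ (by linarith)]
  rcases Nat.eq_zero_or_pos r with rfl | hr
  -- With no new row only the slack is required; the cap `1 / 4` is chosen below `1 - ln 2 > 0.3`.
  · have h := le_mismatch_of_ne_zero hk1 hau hav huv
    have h1 : (1 - Real.log 2) * Real.log 2 ≤ k * mismatch k a u v := by
      calc _ = k * ((1 - Real.log 2) * (Real.log 2 / k)) := by field_simp
        _ ≤ _ := by gcongr
    have h2 : 0.3 * Real.log 2 ≤ k * mismatch k a u v := by nlinarith
    have h3 : k * mismatch k a u v ≤ (1 + ε) * ks * (k * mismatch k a u v) :=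
      le_mul_of_one_le_left (by linarith) (by nlinarith)
    have h4 : min ε (1 / 4) * Real.log 2 ≤ 1 / 4 * Real.log 2 := by gcongr; exact min_le_right _ _
    push_cast
    linarith
  have hm := min_le_mismatch (u := u) hav
  have hL := le_mismatch_left hks hkt hk hr hru har
  have hR := le_mismatch_right hks hkt hk hau hru har
  have hr1 : (1 : ℝ) ≤ r := by exact_mod_cast hr
  have hkks : (0 : ℝ) ≤ k * ks := by positivity
  have hmm := mul_le_mul_of_nonneg_left hm hkks
  rw [mul_min_of_nonneg _ _ hkks] at hmm
  rcases Nat.lt_or_ge k 2 with h | h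
  · have hk1' : k = 1 := by omega
    have hks1 : ks = 1 := Nat.eq_one_of_mul_eq_one_right (hk.symm.trans hk1')
    have he := hεk hk1'
    have hr1' : r = 1 := by
      have : r * 1 ≤ r * kt := Nat.mul_le_mul_left _ hkt
      omega
    subst hk1' hks1 hr1'
    -- The constant comes from `2 (1 - ln 2) > 0.6`; then `(1 + 6/5) * 0.6 = 1.32` exceeds the
    -- required `1 + 1/4`.
    have hbound : 0.6 * Real.log 2 ≤ ((1 : ℕ) : ℝ) * ((1 : ℕ) : ℝ) * mismatch 1 a u v := by
      refine le_trans (le_min ?_ ?_) hmm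
      · refine le_trans ?_ hL
        push_cast; linarith
      · refine le_trans ?_ hR
        push_cast; norm_num; nlinarith
    push_cast at hbound ⊢
    have h4 : min ε (1 / 4) * Real.log 2 ≤ 1 / 4 * Real.log 2 := by gcongr; exact min_le_right _ _
    nlinarith
  · have hbound : r * Real.log 2 ≤ k * ks * mismatch k a u v := by
      refine le_trans (le_min hL (le_trans ?_ hR)) hmm
      rw [mul_assoc]
      have := log_two_le_mul_pow_mul_one_sub_pow hks h
      gcongr
    have h4 : min ε (1 / 4) ≤ r * ε := by
      refine (min_le_left _ _).trans ?_
      nlinarith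
    calc (r + min ε (1 / 4)) * Real.log 2 ≤ (r + r * ε) * Real.log 2 := by gcongr
      _ = (1 + ε) * (r * Real.log 2) := by ring
      _ ≤ (1 + ε) * (k * ks * mismatch k a u v) := by gcongr
      _ = _ := by ring

/-- The product in the hypothesis is `ln (1 / ln 2)`, which is at most `1 / ln 2 - 1 ≤ 0.4427 < 1 /
2.2`. The weaker bound `6 / 5` suffices for the case `k = 1`. -/
theorem lt_of_one_div_log_two_lt {ε : ℝ}
    (h : 1 / (Real.log 2 * Real.logb 2 (1 / Real.log 2)) - 1 < ε) : 6 / 5 ≤ ε := by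
  have hl := Real.log_two_lt_d9
  have hl0 := Real.log_two_gt_d9
  have h1 : Real.log 2 * Real.logb 2 (1 / Real.log 2) = Real.log (1 / Real.log 2) := by
    unfold Real.logb; field_simp
  have h2 : Real.log (1 / Real.log 2) ≤ 1 / Real.log 2 - 1 :=
    Real.log_le_sub_one_of_pos (by positivity)
  have h3 : 1 / Real.log 2 ≤ 1.4427 := by
    rw [div_le_iff₀ (by linarith)]; linarith
  have h4 : 0 < Real.log (1 / Real.log 2) := Real.log_pos (by
    rw [lt_div_iff₀ (by linarith)]; linarith)
  rw [h1] at h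
  have h5 : 2.2 ≤ 1 / Real.log (1 / Real.log 2) := by
    rw [le_div_iff₀ h4]; linarith
  linarith

/-! ### The probability that two selections have the same superposition -/

section Pairwise

variable {n T l b : ℕ}

/-- The bins in which a word other than the all-zero word is selected. -/
def active (f : Fin n × Fin T → Fin (l + 1)) : Finset (Fin n × Fin T) :=
  Finset.univ.filter fun e => f e ≠ 0

/-- The random codewords selected by `f`. -/
def wordSet (f : Fin n × Fin T → Fin (l + 1)) : Finset (Fin n × Fin T × Fin l) :=
  Finset.univ.filter fun x => f (x.1, x.2.1) = x.2.2.succ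

/-- The OR of the words with numbers `f`, one from each bin. -/
noncomputable def orWord (C : Codebook n T l b) (f : Fin n × Fin T → Fin (l + 1)) : Word b :=
  Finset.univ.sup fun e => codeword C e.1 e.2 (f e)

theorem mem_active {f : Fin n × Fin T → Fin (l + 1)} {e : Fin n × Fin T} :
    e ∈ active f ↔ f e ≠ 0 := by
  simp [active]

theorem mem_wordSet {f : Fin n × Fin T → Fin (l + 1)} {x : Fin n × Fin T × Fin l} :
    x ∈ wordSet f ↔ f (x.1, x.2.1) = x.2.2.succ := by
  simp [wordSet]

theorem card_wordSet (f : Fin n × Fin T → Fin (l + 1)) : (wordSet f).card = (active f).card := by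
  refine Finset.card_bij (fun x _ => (x.1, x.2.1)) ?_ ?_ ?_
  · intro x hx
    rw [mem_wordSet] at hx
    rw [mem_active, hx]
    exact Fin.succ_ne_zero _
  · rintro ⟨m, i, j⟩ hx ⟨m', i', j'⟩ hx' h
    simp only [Prod.mk.injEq] at h
    obtain ⟨rfl, rfl⟩ := h
    rw [mem_wordSet] at hx hx'
    have : j = j' := Fin.succ_injective _ (hx.symm.trans hx')
    rw [this]
  · intro e he
    rw [mem_active] at he
    obtain ⟨j, hj⟩ := Fin.exists_succ_eq.2 he
    exact ⟨(e.1, e.2, j), by rw [mem_wordSet]; exact hj.symm, rfl⟩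

theorem card_wordSet_inter (f g : Fin n × Fin T → Fin (l + 1)) :
    (wordSet f ∩ wordSet g).card = ((active f).filter fun e => f e = g e).card := by
  have h1 : wordSet f ∩ wordSet g = wordSet fun e => if f e = g e then f e else 0 := by
    ext x
    simp only [Finset.mem_inter, mem_wordSet]
    split_ifs with h
    · rw [← h, and_self]
    · constructor
      · rintro ⟨h1, h2⟩; exact absurd (h1.trans h2.symm) h
      · intro h0; exact absurd h0.symm (Fin.succ_ne_zero _)
  rw [h1, card_wordSet]
  congr 1
  ext e
  simp only [mem_active, Finset.mem_filter]
  split_ifs with h <;> simp [h]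

theorem codeword_zero (C : Codebook n T l b) (m : Fin n) (i : Fin T) :
    codeword C m i 0 = ⊥ := rfl

theorem codeword_succ (C : Codebook n T l b) (m : Fin n) (i : Fin T) (j : Fin l) (t : Fin b) :
    codeword C m i j.succ t = C (m, i, j, t) := rfl

theorem orWord_apply_eq_false (C : Codebook n T l b) (f : Fin n × Fin T → Fin (l + 1)) (t : Fin b) :
    orWord C f t = false ↔ ∀ x ∈ wordSet f, C (x.1, x.2.1, x.2.2, t) = false := by
  unfold orWord
  rw [Finset.sup_apply, show false = (⊥ : Bool) from rfl, Finset.sup_eq_bot_iff]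
  constructor
  · intro h x hx
    have := h (x.1, x.2.1) (Finset.mem_univ _)
    rw [mem_wordSet] at hx
    rwa [hx, codeword_succ] at this
  · intro h e _
    by_cases he : f e = 0
    · rw [he, codeword_zero]; rfl
    · obtain ⟨j, hj⟩ := Fin.exists_succ_eq.2 he
      rw [← hj, codeword_succ]
      exact h (e.1, e.2, j) (by rw [mem_wordSet]; exact hj.symm)

/-! ### Independence across bit positions -/

/-- The law of the bits of the codewords at a fixed position. -/
noncomputable def bitLaw (n T l k : ℕ) : Measure (Fin n × Fin T × Fin l → Bool) :=
  Measure.pi fun _ => ProbabilityTheory.bernoulliMeasure true false (bitMean k)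

instance (k : ℕ) : IsProbabilityMeasure (bitLaw n T l k) := by
  unfold bitLaw; infer_instance

/-- Regrouping the coordinates by bit position exhibits the codebook as `b` independent copies of
one position, the source of the `b`-th powers below. -/
theorem codebookLaw_eq_map (k : ℕ) :
    codebookLaw n T l b k = (Measure.pi fun _ : Fin b => bitLaw n T l k).map
      fun D x => D x.2.2.2 (x.1, x.2.1, x.2.2.1) := by
  unfold codebookLaw
  refine Measure.pi_eq fun s hs => ?_
  rw [Measure.map_apply (by fun_prop) (MeasurableSet.univ_pi hs)]
  have : (fun (D : Fin b → Fin n × Fin T × Fin l → Bool) (x : Fin n × Fin T × Fin l × Fin b) =>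
      D x.2.2.2 (x.1, x.2.1, x.2.2.1)) ⁻¹' Set.univ.pi s =
      Set.univ.pi fun t => Set.univ.pi fun x => s (x.1, x.2.1, x.2.2, t) := by
    ext D
    simp only [Set.mem_preimage, Set.mem_univ_pi]
    exact ⟨fun h t x => h (x.1, x.2.1, x.2.2, t), fun h x => h x.2.2.2 (x.1, x.2.1, x.2.2.1)⟩
  rw [this, Measure.pi_pi]
  simp only [bitLaw, Measure.pi_pi]
  simp only [Fintype.prod_prod_type]
  rw [Finset.prod_comm]
  refine Finset.prod_congr rfl fun m _ => ?_
  rw [Finset.prod_comm]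
  refine Finset.prod_congr rfl fun i _ => ?_
  rw [Finset.prod_comm]

theorem bitLaw_real_forall_false (k : ℕ) (S : Finset (Fin n × Fin T × Fin l)) :
    (bitLaw n T l k).real {D | ∀ x ∈ S, D x = false} = (1 - Real.log 2 / k) ^ S.card := by
  classical
  have : {D : Fin n × Fin T × Fin l → Bool | ∀ x ∈ S, D x = false} =
      Set.univ.pi fun x => if x ∈ S then {false} else Set.univ := by
    ext D
    simp only [Set.mem_ofPred_eq, Set.mem_univ_pi]
    refine forall_congr' fun x => ?_
    split_ifs with h <;> simp [h]
  rw [this, measureReal_def, bitLaw, Measure.pi_pi, ENNReal.toReal_prod]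
  have : ∀ x, (ProbabilityTheory.bernoulliMeasure true false (bitMean k)
      (if x ∈ S then {false} else Set.univ)).toReal = if x ∈ S then 1 - Real.log 2 / k else 1 := by
    intro x
    split_ifs with h
    · rw [← measureReal_def, ProbabilityTheory.bernoulliMeasure_real_apply _ (by simp)]
      simp [bitMean]
    · simp
  simp only [this]
  rw [Finset.prod_ite_mem, Finset.univ_inter, Finset.prod_const]

/-- The complement is the symmetric difference of two all-zero events whose intersection is the
all-zero event of `S ∪ S'`. -/
theorem bitLaw_real_iff (k : ℕ) (S S' : Finset (Fin n × Fin T × Fin l)) :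
    (bitLaw n T l k).real {D | (∀ x ∈ S, D x = false) ↔ ∀ x ∈ S', D x = false} =
      1 - ((1 - Real.log 2 / k) ^ S.card + (1 - Real.log 2 / k) ^ S'.card
        - 2 * (1 - Real.log 2 / k) ^ (S ∪ S').card) := by
  classical
  set A := {D : Fin n × Fin T × Fin l → Bool | ∀ x ∈ S, D x = false}
  set B := {D : Fin n × Fin T × Fin l → Bool | ∀ x ∈ S', D x = false}
  have hm : ∀ s : Set (Fin n × Fin T × Fin l → Bool), MeasurableSet s :=
    fun s => s.toFinite.measurableSet
  have hAB : A ∩ B = {D | ∀ x ∈ S ∪ S', D x = false} := by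
    ext D
    simp only [A, B, Set.mem_inter_iff, Set.mem_ofPred_eq, Finset.mem_union, or_imp, forall_and]
  have hset : {D | (∀ x ∈ S, D x = false) ↔ ∀ x ∈ S', D x = false} = ((A \ B) ∪ (B \ A))ᶜ := by
    ext D
    simp only [A, B, Set.mem_ofPred_eq, Set.mem_compl_iff, Set.mem_union, Set.mem_sdiff]
    tauto
  have h1 := measureReal_inter_add_sdiff (μ := bitLaw n T l k) (s := A) (hm B)
  have h2 := measureReal_inter_add_sdiff (μ := bitLaw n T l k) (s := B) (hm A)
  rw [Set.inter_comm] at h2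
  rw [hset, probReal_compl_eq_one_sub (hm _),
    measureReal_union (Set.disjoint_sdiff_left.mono_right Set.sdiff_subset) (hm _)]
  rw [hAB, bitLaw_real_forall_false] at h1 h2
  rw [bitLaw_real_forall_false] at h1 h2
  linarith

theorem codebookLaw_real_orWord_eq (k : ℕ) (f g : Fin n × Fin T → Fin (l + 1)) :
    (codebookLaw n T l b k).real {C | orWord C f = orWord C g} =
      (1 - ((1 - Real.log 2 / k) ^ (active f).card + (1 - Real.log 2 / k) ^ (active g).card
        - 2 * (1 - Real.log 2 / k) ^ (wordSet f ∪ wordSet g).card)) ^ b := by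
  have hm : MeasurableSet {C : Codebook n T l b | orWord C f = orWord C g} :=
    (Set.toFinite _).measurableSet
  rw [codebookLaw_eq_map, map_measureReal_apply (by fun_prop) hm]
  have : (fun (D : Fin b → Fin n × Fin T × Fin l → Bool) (x : Fin n × Fin T × Fin l × Fin b) =>
      D x.2.2.2 (x.1, x.2.1, x.2.2.1)) ⁻¹' {C | orWord C f = orWord C g} =
      Set.univ.pi fun _ : Fin b =>
        {D | (∀ x ∈ wordSet f, D x = false) ↔ ∀ x ∈ wordSet g, D x = false} := by
    ext D
    simp only [Set.mem_preimage, Set.mem_ofPred_eq, Set.mem_univ_pi, funext_iff]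
    refine forall_congr' fun t => ?_
    have h1 := orWord_apply_eq_false (fun x : Fin n × Fin T × Fin l × Fin b =>
      D x.2.2.2 (x.1, x.2.1, x.2.2.1)) f t
    have h2 := orWord_apply_eq_false (fun x : Fin n × Fin T × Fin l × Fin b =>
      D x.2.2.2 (x.1, x.2.1, x.2.2.1)) g t
    simp only [Prod.mk.eta] at h1 h2
    rw [← h1, ← h2]
    cases orWord _ f t <;> cases orWord _ g t <;> simp
  rw [this, measureReal_def, Measure.pi_pi, ENNReal.toReal_prod]
  simp only [← measureReal_def, bitLaw_real_iff, Finset.prod_const, Finset.card_univ,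
    Fintype.card_fin, card_wordSet]

/-! ### Shared and differing words of two selections -/

/-- The number of bins in which `f` and `g` select the same random word. -/
def common (f g : Fin n × Fin T → Fin (l + 1)) : ℕ :=
  ((active f).filter fun e => f e = g e).card

theorem common_le_left (f g : Fin n × Fin T → Fin (l + 1)) : common f g ≤ (active f).card :=
  Finset.card_filter_le _ _

theorem common_comm (f g : Fin n × Fin T → Fin (l + 1)) : common f g = common g f := by
  unfold common
  rw [← card_wordSet_inter, ← card_wordSet_inter, Finset.inter_comm]

theorem codebookLaw_real_orWord_eq_mismatch (k : ℕ) (f g : Fin n × Fin T → Fin (l + 1)) :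
    (codebookLaw n T l b k).real {C | orWord C f = orWord C g} =
      (1 - mismatch k (common f g) ((active f).card - common f g)
        ((active g).card - common f g)) ^ b := by
  rw [codebookLaw_real_orWord_eq]
  have h1 := common_le_left f g
  have h2 := common_le_left g f
  rw [← common_comm] at h2
  have h3 := Finset.card_union_add_card_inter (wordSet f) (wordSet g)
  rw [card_wordSet_inter, card_wordSet, card_wordSet] at h3
  unfold mismatch
  change _ + common f g = _ at h3
  congr 6 <;> omega

theorem ne_zero_of_ne {f g : Fin n × Fin T → Fin (l + 1)} (h : f ≠ g) :
    (active f).card - common f g ≠ 0 ∨ (active g).card - common f g ≠ 0 := by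
  by_contra! hc
  have h1 := common_le_left f g
  have h2 := common_le_left g f
  rw [← common_comm] at h2
  have h3 : (active f).filter (fun e => f e = g e) = active f :=
    Finset.eq_of_subset_of_card_le (Finset.filter_subset _ _) (by unfold common at hc; omega)
  have h4 : (active g).filter (fun e => g e = f e) = active g :=
    Finset.eq_of_subset_of_card_le (Finset.filter_subset _ _)
      (by rw [common_comm] at hc; unfold common at hc; omega)
  refine h (funext fun e => ?_)
  by_cases hf : f e = 0
  · by_cases hg : g e = 0
    · rw [hf, hg]
    · have := mem_active.2 hg
      rw [← h4, Finset.mem_filter] at this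
      exact this.2.symm
  · have := mem_active.2 hf
    rw [← h3, Finset.mem_filter] at this
    exact this.2

end Pairwise

/-! ### The union bound -/

/-- This is `choose N k ≥ (N / k) ^ k`. The induction rests on `k (N + 1) ≤ (k + 1) N` for `k ≤ N`.
-/
theorem pow_le_pow_mul_choose {N k : ℕ} (h : k ≤ N) : N ^ k ≤ k ^ k * N.choose k := by
  induction k generalizing N with
  | zero => simp
  | succ k ih =>
    obtain ⟨N, rfl⟩ : ∃ N', N = N' + 1 := ⟨N - 1, by omega⟩
    have hkN : k ≤ N := by omega
    have h1 : (N + 1) ^ k ≤ (k + 1) ^ k * N.choose k := by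
      rcases Nat.eq_zero_or_pos k with rfl | hk
      · simp
      refine Nat.le_of_mul_le_mul_left ?_ (pow_pos hk k)
      calc k ^ k * (N + 1) ^ k = (k * (N + 1)) ^ k := (mul_pow _ _ _).symm
        _ ≤ ((k + 1) * N) ^ k := Nat.pow_le_pow_left (by nlinarith) k
        _ = (k + 1) ^ k * N ^ k := mul_pow _ _ _
        _ ≤ (k + 1) ^ k * (k ^ k * N.choose k) := Nat.mul_le_mul_left _ (ih hkN)
        _ = k ^ k * ((k + 1) ^ k * N.choose k) := by ring
    calc (N + 1) ^ (k + 1) = (N + 1) * (N + 1) ^ k := by ring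
      _ ≤ (N + 1) * ((k + 1) ^ k * N.choose k) := Nat.mul_le_mul_left _ h1
      _ = (k + 1) ^ k * ((N + 1) * N.choose k) := by ring
      _ = (k + 1) ^ (k + 1) * (N + 1).choose (k + 1) := by
          rw [Nat.add_one_mul_choose_eq]; ring

/-- Splits the decay in two: `(1 / N) ^ r` offsets the number of choices of `r` new rows, and `N ^
(-η)` is left over and tends to 0. The constant bounds `ks ^ (r + η)`. -/
theorem choose_rpow_neg_le {N ks K r : ℕ} {g η : ℝ} (hks : 1 ≤ ks) (hN : ks ≤ N) (hK : ks ≤ K)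
    (hg0 : 0 ≤ g) (hrK : r ≤ K) (hη0 : 0 ≤ η) (hη1 : η ≤ 1) (hg : r + η ≤ g * ks) :
    ((N.choose ks : ℕ) : ℝ) ^ (-g) ≤ (K : ℝ) ^ (K + 1) * (N : ℝ) ^ (-η) * (1 / (N : ℝ)) ^ r := by
  have hks0 : (0 : ℝ) < ks := by exact_mod_cast hks
  have hNR : (0 : ℝ) < N := by exact_mod_cast hks.trans hN
  have hKR : (1 : ℝ) ≤ K := by exact_mod_cast hks.trans hK
  have h1 : (1 : ℝ) ≤ N / ks := by
    rw [one_le_div hks0]; exact_mod_cast hN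
  have h2 : ((N : ℝ) / ks) ^ ks ≤ (N.choose ks : ℕ) := by
    rw [div_pow, div_le_iff₀ (by positivity), mul_comm]
    exact_mod_cast pow_le_pow_mul_choose hN
  calc ((N.choose ks : ℕ) : ℝ) ^ (-g) ≤ (((N : ℝ) / ks) ^ ks) ^ (-g) :=
        Real.rpow_le_rpow_of_nonpos (by positivity) h2 (by linarith)
    _ = ((N : ℝ) / ks) ^ (-(g * ks)) := by
        rw [← Real.rpow_natCast, ← Real.rpow_mul (by positivity)]; congr 1; ring
    _ ≤ ((N : ℝ) / ks) ^ (-(r + η)) := Real.rpow_le_rpow_of_exponent_le h1 (by linarith)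
    _ = (ks : ℝ) ^ (r + η) * ((N : ℝ) ^ (-η) * (1 / (N : ℝ)) ^ r) := by
        rw [Real.div_rpow hNR.le hks0.le, Real.rpow_neg hks0.le, div_inv_eq_mul, mul_comm,
          neg_add_rev, Real.rpow_add hNR, Real.rpow_neg hNR.le (r : ℝ), Real.rpow_natCast,
          one_div, inv_pow]
    _ ≤ (K : ℝ) ^ (K + 1) * ((N : ℝ) ^ (-η) * (1 / (N : ℝ)) ^ r) := by
        refine mul_le_mul_of_nonneg_right ?_ (by positivity)
        calc (ks : ℝ) ^ (r + η) ≤ (K : ℝ) ^ (r + η) :=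
              Real.rpow_le_rpow hks0.le (by exact_mod_cast hK) (by positivity)
          _ ≤ (K : ℝ) ^ ((K + 1 : ℕ) : ℝ) := by
              refine Real.rpow_le_rpow_of_exponent_le hKR ?_
              have : (r : ℝ) ≤ K := by exact_mod_cast hrK
              push_cast; linarith
          _ = _ := Real.rpow_natCast _ _
    _ = _ := by ring

theorem one_sub_pow_le_rpow_neg {δ B θ : ℝ} {b : ℕ} (hδ0 : 0 ≤ δ) (hδ1 : δ ≤ 1) (hθ : 0 < θ)
    (hb : B * Real.logb 2 θ ≤ b) : (1 - δ) ^ b ≤ θ ^ (-(B * δ / Real.log 2)) := by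
  have hl : 0 < Real.log 2 := Real.log_pos (by norm_num)
  calc (1 - δ) ^ b ≤ (Real.exp (-δ)) ^ b :=
        pow_le_pow_left₀ (by linarith) (Real.one_sub_le_exp_neg _) b
    _ = Real.exp (b * -δ) := (Real.exp_nat_mul _ _).symm
    _ ≤ Real.exp (Real.log θ * -(B * δ / Real.log 2)) := by
        refine Real.exp_le_exp.2 ?_
        have h1 : Real.log θ * -(B * δ / Real.log 2) = -(B * Real.logb 2 θ * δ) := by
          unfold Real.logb; field_simp
        rw [h1]
        nlinarith
    _ = _ := (Real.rpow_def_of_pos hθ _).symm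

/-- The sum expands the product of `1 + w i`, with `w = 1` on `A` and `1 / N` elsewhere. It is at
most `2 ^ |A| (1 + 1/N) ^ N`, and `(1 + 1/N) ^ N ≤ e < 3`. -/
theorem sum_inv_pow_card_sdiff_le {α : Type*} [Fintype α] [DecidableEq α] [Nonempty α]
    (A : Finset α) :
    ∑ R : Finset α, (1 / (Fintype.card α : ℝ)) ^ (R \ A).card ≤ 3 * 2 ^ A.card := by
  set N : ℝ := ((Fintype.card α : ℕ) : ℝ) with hN
  have hN0 : 0 < N := by rw [hN]; exact_mod_cast Fintype.card_pos
  have h1 : ∀ R : Finset α, (1 / N) ^ (R \ A).card = ∏ i ∈ R, (if i ∈ A then 1 else 1 / N) := by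
    intro R
    rw [Finset.prod_ite, Finset.prod_const_one, one_mul, Finset.prod_const,
      Finset.sdiff_eq_filter]
  simp only [h1]
  rw [← Finset.powerset_univ, ← Finset.prod_one_add]
  calc ∏ i : α, (1 + if i ∈ A then 1 else 1 / N)
      ≤ ∏ i : α, ((if i ∈ A then 2 else 1) * (1 + 1 / N)) := by
        refine Finset.prod_le_prod (fun i _ => by split_ifs <;> positivity) fun i _ => ?_
        have : 0 < 1 / N := by positivity
        split_ifs <;> linarith
    _ = 2 ^ A.card * (1 + 1 / N) ^ Fintype.card α := by
        rw [Finset.prod_mul_distrib, Finset.prod_const, Finset.prod_ite_mem, Finset.univ_inter,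
          Finset.prod_const, Finset.card_univ]
    _ ≤ 2 ^ A.card * 3 := by
        refine mul_le_mul_of_nonneg_left ?_ (by positivity)
        calc (1 + 1 / N) ^ Fintype.card α ≤ (Real.exp (1 / N)) ^ Fintype.card α :=
              pow_le_pow_left₀ (by positivity) (by linarith [Real.add_one_le_exp (1 / N)]) _
          _ = Real.exp 1 := by
              rw [← Real.exp_nat_mul, ← hN, mul_one_div_cancel hN0.ne']
          _ ≤ 3 := by linarith [Real.exp_one_lt_d9]
    _ = _ := mul_comm _ _

/-! ### Counting selections by their active rows and columns -/

section Union

variable {n T l b : ℕ} {α β : Type*} [DecidableEq α] [DecidableEq β]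

/-- The rows (the image under `ρ`) of the bins in which a random word is selected. -/
def activeRows (ρ : Fin n × Fin T → α) (f : Fin n × Fin T → Fin (l + 1)) : Finset α :=
  (active f).image ρ

theorem card_filter_box_le {ρ : Fin n × Fin T → α} {κ : Fin n × Fin T → β}
    (hinj : Function.Injective fun e => (ρ e, κ e)) (R : Finset α) (S : Finset β) :
    (Finset.univ.filter fun e => ρ e ∈ R ∧ κ e ∈ S).card ≤ R.card * S.card := by
  rw [← Finset.card_product]
  exact Finset.card_le_card_of_injOn (fun e => (ρ e, κ e))
    (fun e he => by simpa using he) hinj.injOn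

theorem card_active_le {ρ : Fin n × Fin T → α} {κ : Fin n × Fin T → β}
    (hinj : Function.Injective fun e => (ρ e, κ e)) (f : Fin n × Fin T → Fin (l + 1)) :
    (active f).card ≤ (activeRows ρ f).card * (activeRows κ f).card := by
  refine le_trans (Finset.card_le_card fun e he => ?_) (card_filter_box_le hinj _ _)
  simp only [Finset.mem_filter, Finset.mem_univ, true_and]
  exact ⟨Finset.mem_image_of_mem _ he, Finset.mem_image_of_mem _ he⟩

/-- Every new row contains an active bin of `f` at which `f` and `g` differ. -/
theorem card_sdiff_activeRows_le (ρ : Fin n × Fin T → α) (f g : Fin n × Fin T → Fin (l + 1)) :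
    (activeRows ρ f \ activeRows ρ g).card ≤ (active f).card - common f g := by
  have h1 : common f g + ((active f).filter fun e => ¬ f e = g e).card = (active f).card :=
    Finset.card_filter_add_card_filter_not _
  have h2 : activeRows ρ f \ activeRows ρ g ⊆
      ((active f).filter fun e => ¬ f e = g e).image ρ := by
    intro i hi
    rw [Finset.mem_sdiff] at hi
    obtain ⟨e, he, rfl⟩ := Finset.mem_image.1 hi.1
    refine Finset.mem_image_of_mem _ (Finset.mem_filter.2 ⟨he, fun hfg => hi.2 ?_⟩)
    refine Finset.mem_image_of_mem _ (mem_active.2 ?_)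
    rw [← hfg]
    exact mem_active.1 he
  have := (Finset.card_le_card h2).trans Finset.card_image_le
  omega

/-- Shared words lie in shared rows, at most `ks - r` of them, with at most `kt` active columns
each. -/
theorem common_add_le {ρ : Fin n × Fin T → α} {κ : Fin n × Fin T → β}
    (hinj : Function.Injective fun e => (ρ e, κ e)) {f g : Fin n × Fin T → Fin (l + 1)}
    {ks kt : ℕ} (hf1 : (activeRows ρ f).card ≤ ks) (hf2 : (activeRows κ f).card ≤ kt) :
    common f g + (activeRows ρ f \ activeRows ρ g).card * kt ≤ ks * kt := by
  have h1 : common f g ≤ (activeRows ρ f ∩ activeRows ρ g).card * (activeRows κ f).card := by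
    refine le_trans (Finset.card_le_card fun e he => ?_) (card_filter_box_le hinj _ _)
    obtain ⟨he, hfg⟩ := Finset.mem_filter.1 he
    simp only [Finset.mem_filter, Finset.mem_univ, true_and, Finset.mem_inter]
    refine ⟨⟨Finset.mem_image_of_mem _ he, Finset.mem_image_of_mem _ (mem_active.2 ?_)⟩,
      Finset.mem_image_of_mem _ he⟩
    rw [← hfg]
    exact mem_active.1 he
  have h2 := Finset.card_inter_add_card_sdiff (activeRows ρ f) (activeRows ρ g)
  calc _ ≤ (activeRows ρ f ∩ activeRows ρ g).card * kt
        + (activeRows ρ f \ activeRows ρ g).card * kt :=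
        Nat.add_le_add_right (h1.trans (Nat.mul_le_mul_left _ hf2)) _
    _ = (activeRows ρ f).card * kt := by rw [← add_mul, h2]
    _ ≤ _ := Nat.mul_le_mul_right _ hf1

/-- The selections whose random words lie in at most `ks` rows and at most `kt` columns. -/
def boxed (ρ : Fin n × Fin T → α) (κ : Fin n × Fin T → β) (l ks kt : ℕ) :
    Finset (Fin n × Fin T → Fin (l + 1)) :=
  Finset.univ.filter fun f => (activeRows ρ f).card ≤ ks ∧ (activeRows κ f).card ≤ kt

theorem mem_boxed {ρ : Fin n × Fin T → α} {κ : Fin n × Fin T → β} {ks kt : ℕ}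
    {f : Fin n × Fin T → Fin (l + 1)} :
    f ∈ boxed ρ κ l ks kt ↔ (activeRows ρ f).card ≤ ks ∧ (activeRows κ f).card ≤ kt := by
  simp [boxed]

/-- Once the active rows and columns are known, a selection is determined by its values on a box of
at most `ks * kt` bins. -/
theorem card_fiber_le {ρ : Fin n × Fin T → α} {κ : Fin n × Fin T → β}
    (hinj : Function.Injective fun e => (ρ e, κ e)) (ks kt : ℕ) (x : Finset α × Finset β) :
    ((boxed ρ κ l ks kt).filter fun f => (activeRows ρ f, activeRows κ f) = x).card ≤
      (l + 1) ^ (ks * kt) := by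
  rcases Finset.eq_empty_or_nonempty
    ((boxed ρ κ l ks kt).filter fun f => (activeRows ρ f, activeRows κ f) = x) with h | ⟨f₀, h₀⟩
  · rw [h]; simp
  obtain ⟨h1, rfl⟩ := Finset.mem_filter.1 h₀
  rw [mem_boxed] at h1
  set B := Finset.univ.filter fun e => ρ e ∈ activeRows ρ f₀ ∧ κ e ∈ activeRows κ f₀ with hB
  have hBc : B.card ≤ ks * kt :=
    (card_filter_box_le hinj _ _).trans (Nat.mul_le_mul h1.1 h1.2)
  calc _ ≤ (Finset.univ : Finset (B → Fin (l + 1))).card := by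
        refine Finset.card_le_card_of_injOn (fun f e => f e) (fun _ _ => Finset.mem_univ _) ?_
        intro f hf f' hf' hff
        have hzero : ∀ f ∈ (boxed ρ κ l ks kt).filter
            (fun f => (activeRows ρ f, activeRows κ f) = (activeRows ρ f₀, activeRows κ f₀)),
            ∀ e ∉ B, f e = 0 := by
          intro f hf e he
          by_contra hne
          have h2 := (Finset.mem_filter.1 hf).2
          rw [Prod.mk.injEq] at h2
          refine he (Finset.mem_filter.2 ⟨Finset.mem_univ _, ?_, ?_⟩)
          · rw [← h2.1]; exact Finset.mem_image_of_mem _ (mem_active.2 hne)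
          · rw [← h2.2]; exact Finset.mem_image_of_mem _ (mem_active.2 hne)
        funext e
        by_cases he : e ∈ B
        · exact congrFun hff ⟨e, he⟩
        · rw [hzero f hf e he, hzero f' hf' e he]
    _ = (l + 1) ^ B.card := by simp
    _ ≤ _ := Nat.pow_le_pow_right (by omega) hBc

variable [Fintype α] [Fintype β] [Nonempty α] [Nonempty β]

theorem sum_boxed_le {ρ : Fin n × Fin T → α} {κ : Fin n × Fin T → β}
    (hinj : Function.Injective fun e => (ρ e, κ e)) (ks kt : ℕ) (A : Finset α) (B : Finset β) :
    ∑ f ∈ boxed ρ κ l ks kt, (1 / (Fintype.card α : ℝ)) ^ (activeRows ρ f \ A).card *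
        (1 / (Fintype.card β : ℝ)) ^ (activeRows κ f \ B).card ≤
      (l + 1) ^ (ks * kt) * ((3 * 2 ^ A.card) * (3 * 2 ^ B.card)) := by
  rw [← Finset.sum_fiberwise _ fun f => (activeRows ρ f, activeRows κ f)]
  calc _ ≤ ∑ x : Finset α × Finset β, (l + 1 : ℝ) ^ (ks * kt) *
        ((1 / (Fintype.card α : ℝ)) ^ (x.1 \ A).card *
          (1 / (Fintype.card β : ℝ)) ^ (x.2 \ B).card) := by
        refine Finset.sum_le_sum fun x _ => ?_
        rw [Finset.sum_congr rfl (g := fun _ => (1 / (Fintype.card α : ℝ)) ^ (x.1 \ A).card *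
          (1 / (Fintype.card β : ℝ)) ^ (x.2 \ B).card), Finset.sum_const, nsmul_eq_mul]
        · refine mul_le_mul_of_nonneg_right ?_ (by positivity)
          exact_mod_cast card_fiber_le hinj ks kt x
        · intro f hf
          rw [← (Finset.mem_filter.1 hf).2]
    _ = (l + 1 : ℝ) ^ (ks * kt) * ((∑ R : Finset α, (1 / (Fintype.card α : ℝ)) ^ (R \ A).card) *
          ∑ S : Finset β, (1 / (Fintype.card β : ℝ)) ^ (S \ B).card) := by
        rw [← Finset.mul_sum, Fintype.sum_prod_type, Finset.sum_mul_sum]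
    _ ≤ _ := by
        gcongr
        · exact sum_inv_pow_card_sdiff_le A
        · exact sum_inv_pow_card_sdiff_le B

theorem codebookLaw_real_orWord_eq_le {ρ : Fin n × Fin T → α} {κ : Fin n × Fin T → β}
    (hinj : Function.Injective fun e => (ρ e, κ e)) {k ks kt K : ℕ} {ε : ℝ} (hε : 0 < ε)
    (hks : 1 ≤ ks) (hkt : 1 ≤ kt) (hk : k = ks * kt) (hkK : k ≤ K) (hεk : k = 1 → 6 / 5 ≤ ε)
    (hα : ks ≤ Fintype.card α) (hβ : kt ≤ Fintype.card β)
    (hb : (1 + ε) * k * Real.logb 2 (((Fintype.card α).choose ks : ℕ) *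
      ((Fintype.card β).choose kt : ℕ)) ≤ b)
    {f g : Fin n × Fin T → Fin (l + 1)} (hf : f ∈ boxed ρ κ l ks kt)
    (hg : g ∈ boxed ρ κ l ks kt) (hfg : f ≠ g) :
    (codebookLaw n T l b k).real {C | orWord C f = orWord C g} ≤
      (K ^ (K + 1) * K ^ (K + 1) * (Fintype.card α * Fintype.card β : ℝ) ^ (-min ε (1 / 4))) *
      ((1 / (Fintype.card α : ℝ)) ^ (activeRows ρ f \ activeRows ρ g).card *
        (1 / (Fintype.card β : ℝ)) ^ (activeRows κ f \ activeRows κ g).card) := by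
  have hinj' : Function.Injective fun e => (κ e, ρ e) := fun e e' h => hinj (by
    simp only [Prod.mk.injEq] at h ⊢; exact h.symm)
  rw [mem_boxed] at hf hg
  have hk' : k = kt * ks := hk.trans (mul_comm _ _)
  have hk1 : 1 ≤ k := hk ▸ Nat.mul_pos hks hkt
  have hfk : (active f).card ≤ k :=
    hk ▸ (card_active_le hinj f).trans (Nat.mul_le_mul hf.1 hf.2)
  have hgk : (active g).card ≤ k :=
    hk ▸ (card_active_le hinj g).trans (Nat.mul_le_mul hg.1 hg.2)
  have hcf := common_le_left f g
  have hcg := common_le_left g f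
  rw [← common_comm] at hcg
  have hksk : ks ≤ k := hk ▸ Nat.le_mul_of_pos_right ks hkt
  have hktk : kt ≤ k := hk' ▸ Nat.le_mul_of_pos_right kt hks
  have hne := ne_zero_of_ne hfg
  set r := (activeRows ρ f \ activeRows ρ g).card
  set c := (activeRows κ f \ activeRows κ g).card
  have hrK : r ≤ K := (Finset.card_le_card Finset.sdiff_subset).trans (by omega)
  have hcK : c ≤ K := (Finset.card_le_card Finset.sdiff_subset).trans (by omega)
  rw [codebookLaw_real_orWord_eq_mismatch]
  have hau : common f g + ((active f).card - common f g) ≤ k := by omega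
  have hav : common f g + ((active g).card - common f g) ≤ k := by omega
  have hrow := add_min_le_mul_mismatch hε hks hkt hk hεk hau hav hne
    (card_sdiff_activeRows_le ρ f g) (hk ▸ common_add_le hinj hf.1 hf.2)
  -- The same inequality with rows and columns exchanged; one mismatch probability serves both
  -- directions.
  have hcol := add_min_le_mul_mismatch hε hkt hks hk' hεk hau hav hne
    (card_sdiff_activeRows_le κ f g) (hk' ▸ common_add_le hinj' hf.2 hf.1)
  have hδ0 : 0 ≤ mismatch k (common f g) ((active f).card - common f g)
      ((active g).card - common f g) := by
    refine le_trans (mul_nonneg ?_ (bitMean k).2.1) (le_mismatch_of_ne_zero hk1 hau hav hne)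
    linarith [Real.log_two_lt_d9]
  have hδ1 : mismatch k (common f g) ((active f).card - common f g)
      ((active g).card - common f g) ≤ 1 := by
    have hp0 : 0 ≤ Real.log 2 / k := (bitMean k).2.1
    have hp1 := log_two_div_le_one k
    unfold mismatch
    set q := 1 - Real.log 2 / k
    have hq0 : 0 ≤ q := by linarith
    have hq1 : q ≤ 1 := by linarith
    rw [pow_add, pow_add, pow_add, pow_add]
    have ha := pow_le_one₀ hq0 hq1 (n := common f g)
    have hu := pow_le_one₀ hq0 hq1 (n := (active f).card - common f g)
    have hv := pow_le_one₀ hq0 hq1 (n := (active g).card - common f g)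
    have ha0 : 0 ≤ q ^ common f g := by positivity
    have hu0 : 0 ≤ q ^ ((active f).card - common f g) := by positivity
    have hv0 : 0 ≤ q ^ ((active g).card - common f g) := by positivity
    generalize q ^ common f g = x at *
    generalize q ^ ((active f).card - common f g) = y at *
    generalize q ^ ((active g).card - common f g) = z at *
    -- On the unit square, `1 - y - z + 2 y z = (1 - y) (1 - z) + y z ≥ 0`.
    have h1 : y + z - 2 * (y * z) ≤ 1 := by nlinarith
    nlinarith
  set δ := mismatch k (common f g) ((active f).card - common f g)
      ((active g).card - common f g)
  set η := min ε (1 / 4 : ℝ)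
  have hη0 : 0 ≤ η := le_min hε.le (by norm_num)
  have hη1 : η ≤ 1 := (min_le_right _ _).trans (by norm_num)
  have hl : 0 < Real.log 2 := Real.log_pos (by norm_num)
  set γ := (1 + ε) * k * δ / Real.log 2 with hγ
  have hγ0 : 0 ≤ γ := by positivity
  have hchα : (0 : ℝ) < ((Fintype.card α).choose ks : ℕ) := by
    exact_mod_cast Nat.choose_pos hα
  have hchβ : (0 : ℝ) < ((Fintype.card β).choose kt : ℕ) := by
    exact_mod_cast Nat.choose_pos hβ
  have hA := choose_rpow_neg_le (g := γ) hks hα (hksk.trans hkK) hγ0 hrK hη0 hη1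
    (hrow.trans_eq (by rw [hγ]; ring))
  have hB := choose_rpow_neg_le (g := γ) hkt hβ (hktk.trans hkK) hγ0 hcK hη0 hη1
    (hcol.trans_eq (by rw [hγ]; ring))
  calc (1 - δ) ^ b ≤ (((Fintype.card α).choose ks : ℕ) *
        ((Fintype.card β).choose kt : ℕ) : ℝ) ^ (-γ) :=
        one_sub_pow_le_rpow_neg hδ0 hδ1 (by positivity) hb
    _ = ((Fintype.card α).choose ks : ℕ) ^ (-γ) * ((Fintype.card β).choose kt : ℕ) ^ (-γ) :=
        Real.mul_rpow hchα.le hchβ.le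
    _ ≤ _ := mul_le_mul hA hB (by positivity) (by positivity)
    _ = _ := by
        rw [Real.mul_rpow (by positivity) (by positivity)]
        ring

/-- The probability that some other selection explains the superposition. -/
theorem codebookLaw_real_exists_le {ρ : Fin n × Fin T → α} {κ : Fin n × Fin T → β}
    (hinj : Function.Injective fun e => (ρ e, κ e)) {k ks kt K : ℕ} {ε : ℝ} (hε : 0 < ε)
    (hks : 1 ≤ ks) (hkt : 1 ≤ kt) (hk : k = ks * kt) (hkK : k ≤ K) (hεk : k = 1 → 6 / 5 ≤ ε)
    (hα : ks ≤ Fintype.card α) (hβ : kt ≤ Fintype.card β)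
    (hb : (1 + ε) * k * Real.logb 2 (((Fintype.card α).choose ks : ℕ) *
      ((Fintype.card β).choose kt : ℕ)) ≤ b)
    {g : Fin n × Fin T → Fin (l + 1)} (hg : g ∈ boxed ρ κ l ks kt) :
    (codebookLaw n T l b k).real
        {C | ∃ f ∈ boxed ρ κ l ks kt, f ≠ g ∧ orWord C f = orWord C g} ≤
      (K ^ (K + 1) * K ^ (K + 1) * ((l + 1) ^ K * ((3 * 2 ^ K) * (3 * 2 ^ K)))) *
        (Fintype.card α * Fintype.card β : ℝ) ^ (-min ε (1 / 4)) := by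
  set W : ℝ := K ^ (K + 1) * K ^ (K + 1) *
    (Fintype.card α * Fintype.card β : ℝ) ^ (-min ε (1 / 4)) with hW
  have hW0 : 0 ≤ W := by positivity
  have hsub : {C : Codebook n T l b | ∃ f ∈ boxed ρ κ l ks kt, f ≠ g ∧ orWord C f = orWord C g} ⊆
      ⋃ f ∈ (boxed ρ κ l ks kt).filter (· ≠ g), {C | orWord C f = orWord C g} := by
    rintro C ⟨f, hf, hne, h⟩
    simp only [Set.mem_iUnion]
    exact ⟨f, Finset.mem_filter.2 ⟨hf, hne⟩, h⟩
  rw [mem_boxed] at hg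
  have hksK : ks ≤ K := (hk ▸ Nat.le_mul_of_pos_right ks hkt).trans hkK
  have hktK : kt ≤ K := ((hk.trans (mul_comm _ _)) ▸ Nat.le_mul_of_pos_right kt hks).trans hkK
  calc _ ≤ (codebookLaw n T l b k).real
        (⋃ f ∈ (boxed ρ κ l ks kt).filter (· ≠ g), {C | orWord C f = orWord C g}) :=
        measureReal_mono hsub (measure_ne_top _ _)
    _ ≤ ∑ f ∈ (boxed ρ κ l ks kt).filter (· ≠ g),
        (codebookLaw n T l b k).real {C | orWord C f = orWord C g} :=
        measureReal_biUnion_finset_le _ _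
    _ ≤ ∑ f ∈ (boxed ρ κ l ks kt).filter (· ≠ g), W *
        ((1 / (Fintype.card α : ℝ)) ^ (activeRows ρ f \ activeRows ρ g).card *
        (1 / (Fintype.card β : ℝ)) ^ (activeRows κ f \ activeRows κ g).card) := by
        refine Finset.sum_le_sum fun f hf => ?_
        rw [Finset.mem_filter] at hf
        exact codebookLaw_real_orWord_eq_le hinj hε hks hkt hk hkK hεk hα hβ hb hf.1
          (mem_boxed.2 hg) hf.2
    _ ≤ ∑ f ∈ boxed ρ κ l ks kt, W *
        ((1 / (Fintype.card α : ℝ)) ^ (activeRows ρ f \ activeRows ρ g).card *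
        (1 / (Fintype.card β : ℝ)) ^ (activeRows κ f \ activeRows κ g).card) :=
        Finset.sum_le_sum_of_subset_of_nonneg (Finset.filter_subset _ _)
          fun _ _ _ => by positivity
    _ ≤ W * ((l + 1) ^ (ks * kt) * ((3 * 2 ^ (activeRows ρ g).card) *
          (3 * 2 ^ (activeRows κ g).card))) := by
        rw [← Finset.mul_sum]
        exact mul_le_mul_of_nonneg_left (sum_boxed_le hinj ks kt _ _) hW0
    _ ≤ W * ((l + 1) ^ K * ((3 * 2 ^ K) * (3 * 2 ^ K))) := by
        have h1 : ((l : ℝ) + 1) ^ (ks * kt) ≤ (l + 1) ^ K :=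
          pow_le_pow_right₀ (by linarith [Nat.cast_nonneg (α := ℝ) l]) (hk ▸ hkK)
        have h2 : (2 : ℝ) ^ (activeRows ρ g).card ≤ 2 ^ K :=
          pow_le_pow_right₀ (by norm_num) (hg.1.trans hksK)
        have h3 : (2 : ℝ) ^ (activeRows κ g).card ≤ 2 ^ K :=
          pow_le_pow_right₀ (by norm_num) (hg.2.trans hktK)
        gcongr
    _ = _ := by rw [hW]; ring

end Union

/-! ### Network and decoder -/

/-- OR is idempotent, so multiple paths do no harm. No node exceeds the total OR, by induction along
links, and each encoder's word survives along its intact path. -/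
theorem RelayNetwork.received_eq_sup {n b : ℕ} (N : RelayNetwork n) (x : Fin n → Word b) :
    N.received x = Finset.univ.sup x := by
  classical
  apply le_antisymm
  · refine Finset.sup_le fun v hv => ?_
    clear hv
    induction v using N.wellFounded_link.induction with
    | _ v ih =>
      rw [N.nodeOutput_eq]
      refine sup_le (Finset.sup_mono (Finset.filter_subset _ _)) (Finset.sup_le fun w hw => ?_)
      exact ih w (Finset.mem_filter.1 hw).2
  · refine Finset.sup_le fun m _ => ?_
    obtain ⟨v, hv, hmv⟩ := N.connected m
    refine le_trans ?_ (Finset.le_sup (f := N.nodeOutput x) hv)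
    clear hv
    induction hmv with
    | refl =>
      rw [N.nodeOutput_eq]
      exact le_sup_of_le_left (Finset.le_sup (f := x) (by simp))
    | @tail v w _ hvw ih =>
      refine ih.trans ?_
      rw [N.nodeOutput_eq x w]
      exact le_sup_of_le_right (Finset.le_sup (f := N.nodeOutput x) (by simpa using hvw))

section Decoder

variable {n T l b : ℕ}

/-- The quantization indices of an ensemble. -/
def indices (Q : ScalarQuantizer l) (x : Fin n → Fin T → ℝ) (e : Fin n × Fin T) : Fin (l + 1) :=
  Q.index (x e.1 e.2)

theorem received_encode (Q : ScalarQuantizer l) (N : RelayNetwork n) (C : Codebook n T l b)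
    (x : Fin n → Fin T → ℝ) :
    (N.received fun m => encode Q C m (x m)) = orWord C (indices Q x) := by
  rw [N.received_eq_sup]
  simp only [encode_eq_sup]
  unfold orWord
  rw [← Finset.univ_product_univ, Finset.sup_product_left]
  rfl

open Classical in
/-- The numbers of the selected words, with number `0` outside of the selected bins. -/
noncomputable def numbers (w : Selection n T l) (e : Fin n × Fin T) : Fin (l + 1) :=
  if e ∈ w.1 then w.2 e.1 e.2 else 0

theorem active_numbers_subset (w : Selection n T l) : active (numbers w) ⊆ w.1 := by
  intro e he
  rw [mem_active] at he
  by_contra h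
  exact he (if_neg h)

theorem numbers_eq_of_active_subset {X : Finset (Fin n × Fin T)} {f : Fin n × Fin T → Fin (l + 1)}
    (h : active f ⊆ X) : numbers (X, fun m i => f (m, i)) = f := by
  funext e
  unfold numbers
  split_ifs with he
  · rfl
  · by_contra hc
    exact he (h (mem_active.2 fun h0 => hc h0.symm))

theorem superpose_eq_orWord (C : Codebook n T l b) (w : Selection n T l) :
    superpose C w = orWord C (numbers w) := by
  unfold superpose orWord numbers
  apply le_antisymm
  · refine Finset.sup_le fun e he => ?_
    refine le_trans (le_of_eq ?_) (Finset.le_sup (Finset.mem_univ e))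
    rw [if_pos he]
  · refine Finset.sup_le fun e _ => ?_
    split_ifs with he
    · exact Finset.le_sup (f := fun e : Fin n × Fin T => codeword C e.1 e.2 (w.2 e.1 e.2)) he
    · rw [codeword_zero]; exact bot_le

theorem reconstruct_eq (Q : ScalarQuantizer l) (w : Selection n T l) (m : Fin n) (i : Fin T) :
    reconstruct Q w m i = Q.level (numbers w (m, i)) := by
  unfold reconstruct numbers
  split_ifs <;> rfl

/-- The indices estimated by the decoder if the indices are `g`. -/
noncomputable def decoded (dec : Codebook n T l b → Word b → Selection n T l)
    (C : Codebook n T l b) (g : Fin n × Fin T → Fin (l + 1)) : Fin n × Fin T → Fin (l + 1) :=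
  numbers (dec C (orWord C g))

theorem output_eq (Q : ScalarQuantizer l) (N : RelayNetwork n)
    (dec : Codebook n T l b → Word b → Selection n T l) (C : Codebook n T l b)
    (x : Fin n → Fin T → ℝ) (m : Fin n) (i : Fin T) :
    output Q N dec C x m i = Q.level (decoded dec C (indices Q x) (m, i)) := by
  unfold output decoded
  rw [received_encode, reconstruct_eq]

/-- The true selection is a candidate of likelihood 1, so the maximizer has non-zero likelihood and
therefore explains the received word. -/
theorem orWord_decoded {σ : JointSparsity} {J : Set (Fin (l + 1))}
    {dec : Codebook n T l b → Word b → Selection n T l} (hdec : IsMLDecoder σ J dec)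
    (C : Codebook n T l b) {g : Fin n × Fin T → Fin (l + 1)} {X : Finset (Fin n × Fin T)}
    (hX : X ∈ σ.supports n T) (hgX : active g ⊆ X) (hJ : ∀ e ∈ X, g e ∈ J) :
    orWord C (decoded dec C g) = orWord C g := by
  have h := (hdec C (orWord C g)).2 (X, fun m i => g (m, i)) ⟨hX, hJ⟩
  unfold likelihood at h
  rw [superpose_eq_orWord, superpose_eq_orWord, numbers_eq_of_active_subset hgX,
    PMF.pure_apply_self] at h
  by_contra hne
  unfold decoded at hne
  refine absurd h ?_
  rw [PMF.pure_apply_of_ne _ _ fun h' => hne (Eq.symm h')]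
  simp

/-- The indices are zero outside of one of the candidate sets of bins. -/
def Feasible (σ : JointSparsity) (f : Fin n × Fin T → Fin (l + 1)) : Prop :=
  ∃ X ∈ σ.supports n T, active f ⊆ X

theorem feasible_decoded {σ : JointSparsity} {J : Set (Fin (l + 1))}
    {dec : Codebook n T l b → Word b → Selection n T l} (hdec : IsMLDecoder σ J dec)
    (C : Codebook n T l b) (g : Fin n × Fin T → Fin (l + 1)) : Feasible σ (decoded dec C g) :=
  ⟨_, (hdec C (orWord C g)).1.1, active_numbers_subset _⟩

/-- As 0 has index 0, the indices inherit the sparsity of the signals. Their support may be too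
small and is enlarged to a candidate set, which admissibility permits. -/
theorem feasible_indices {σ : JointSparsity} (hσ : σ.Admissible n T) (Q : ScalarQuantizer l)
    {x : Fin n → Fin T → ℝ} (hx : σ.IsSparse x) : Feasible σ (indices Q x) := by
  have hne : ∀ e ∈ active (indices Q x), x e.1 e.2 ≠ 0 := by
    intro e he h0
    rw [mem_active] at he
    exact he (by rw [indices, h0, Q.index_zero])
  cases σ with
  | overall k =>
    have h1 : (active (indices Q x)).card ≤ k := by
      refine le_trans ?_ hx
      rw [← Set.ncard_coe_finset]
      exact Set.ncard_le_ncard (fun e he => hne e he) (Set.toFinite _)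
    obtain ⟨X, hX, hXk⟩ := Finset.exists_superset_card_eq h1 (by simpa using hσ.2)
    exact ⟨X, hXk, hX⟩
  | structured kt ks =>
    have h1 : (activeRows Prod.fst (indices Q x)).card ≤ ks := by
      refine le_trans ?_ hx.2
      rw [← Set.ncard_coe_finset]
      refine Set.ncard_le_ncard (fun m hm => ?_) (Set.toFinite _)
      obtain ⟨e, he, rfl⟩ := Finset.mem_image.1 hm
      exact ⟨e.2, hne e he⟩
    have h2 : (activeRows Prod.snd (indices Q x)).card ≤ kt := by
      refine le_trans ?_ hx.1
      rw [← Set.ncard_coe_finset]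
      refine Set.ncard_le_ncard (fun m hm => ?_) (Set.toFinite _)
      obtain ⟨e, he, rfl⟩ := Finset.mem_image.1 hm
      exact ⟨e.1, hne e he⟩
    obtain ⟨A, hA, hAk⟩ := Finset.exists_superset_card_eq h1 (by simpa using hσ.2.2)
    obtain ⟨B, hB, hBk⟩ := Finset.exists_superset_card_eq h2 (by simpa using hσ.1.2)
    refine ⟨A ×ˢ B, ⟨A, B, hAk, hBk, rfl⟩, fun e he => Finset.mem_product.2
      ⟨hA (Finset.mem_image_of_mem _ he), hB (Finset.mem_image_of_mem _ he)⟩⟩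

theorem Feasible.card_active_le {σ : JointSparsity} {f : Fin n × Fin T → Fin (l + 1)}
    (hf : Feasible σ f) : (active f).card ≤ σ.size := by
  obtain ⟨X, hX, hfX⟩ := hf
  refine (Finset.card_le_card hfX).trans ?_
  cases σ with
  | overall k => exact le_of_eq hX
  | structured kt ks =>
    obtain ⟨A, B, hA, hB, rfl⟩ := hX
    rw [Finset.card_product, hA, hB, JointSparsity.size]

/-! ### Uniform bound for given signals -/

/-- The bound on the error probability for given signals. -/
noncomputable def errorBound (l K : ℕ) (ε : ℝ) (x : ℕ) : ℝ :=
  (K ^ (K + 1) * K ^ (K + 1) * ((l + 1) ^ K * ((3 * 2 ^ K) * (3 * 2 ^ K)))) *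
    (x : ℝ) ^ (-min ε (1 / 4))

theorem errorBound_nonneg (l K : ℕ) (ε : ℝ) (x : ℕ) : 0 ≤ errorBound l K ε x := by
  unfold errorBound; positivity

theorem tendsto_errorBound (l K : ℕ) {ε : ℝ} (hε : 0 < ε) :
    Tendsto (errorBound l K ε) atTop (𝓝 0) := by
  unfold errorBound
  have h := (tendsto_rpow_neg_atTop (y := min ε (1 / 4)) (lt_min hε (by norm_num))).comp
    (tendsto_natCast_atTop_atTop (R := ℝ))
  simpa using h.const_mul
    ((K : ℝ) ^ (K + 1) * K ^ (K + 1) * ((l + 1) ^ K * ((3 * 2 ^ K) * (3 * 2 ^ K))))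

theorem codebookLaw_real_ambiguous_le {σ : JointSparsity} (hσ : σ.Admissible n T) {K : ℕ} {ε : ℝ}
    (hε : 0 < ε) (hK : σ.size ≤ K) (hε1 : σ.size = 1 → 6 / 5 ≤ ε)
    (hb : (1 + ε) * σ.size * Real.logb 2 (σ.theta n T) ≤ b)
    {g : Fin n × Fin T → Fin (l + 1)} (hg : Feasible σ g) :
    (codebookLaw n T l b σ.size).real {C | ∃ f, Feasible σ f ∧ f ≠ g ∧ orWord C f = orWord C g} ≤
      errorBound l K ε (n * T) := by
  cases σ with
  | overall k =>
    have : Nonempty (Fin n × Fin T) := by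
      rw [← Fintype.card_pos_iff]
      simpa only [Fintype.card_prod, Fintype.card_fin] using Nat.lt_of_lt_of_le hσ.1 hσ.2
    have hbox : ∀ f : Fin n × Fin T → Fin (l + 1), Feasible (.overall k) f →
        f ∈ boxed id (fun _ => ()) l k 1 := by
      rintro f hf
      rw [mem_boxed]
      refine ⟨Finset.card_image_le.trans hf.card_active_le, ?_⟩
      exact (Finset.card_le_univ _).trans (by simp)
    -- Overall sparsity is the grid in which every bin is its own row and there is one column.
    have h := codebookLaw_real_exists_le (n := n) (T := T) (l := l) (b := b) (ρ := id)
      (κ := fun _ => ()) (fun e e' h => (Prod.mk.inj h).1) hε hσ.1 le_rfl (mul_one k).symm hK hε1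
      (by simpa using hσ.2) (by simp) (by simpa [JointSparsity.size, JointSparsity.theta] using hb)
      (hbox g hg)
    refine (measureReal_mono ?_ (measure_ne_top _ _)).trans (h.trans_eq ?_)
    · rintro C ⟨f, hf, h⟩
      exact ⟨f, hbox f hf, h⟩
    · simp [errorBound]
  | structured kt ks =>
    obtain ⟨⟨hkt, hktT⟩, hks, hksn⟩ := hσ
    have : Nonempty (Fin n) := ⟨⟨0, by omega⟩⟩
    have : Nonempty (Fin T) := ⟨⟨0, by omega⟩⟩
    have hbox : ∀ f : Fin n × Fin T → Fin (l + 1), Feasible (.structured kt ks) f →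
        f ∈ boxed Prod.fst Prod.snd l ks kt := by
      rintro f ⟨X, ⟨A, B, hA, hB, rfl⟩, hfX⟩
      rw [mem_boxed, ← hA, ← hB]
      refine ⟨Finset.card_le_card ?_, Finset.card_le_card ?_⟩
      · refine Finset.image_subset_iff.2 fun e he => (Finset.mem_product.1 (hfX he)).1
      · refine Finset.image_subset_iff.2 fun e he => (Finset.mem_product.1 (hfX he)).2
    have h := codebookLaw_real_exists_le (n := n) (T := T) (l := l) (b := b) (ρ := Prod.fst)
      (κ := Prod.snd) (fun e e' h => h) hε hks hkt rfl hK hε1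
      (by simpa using hksn) (by simpa using hktT)
      (by simpa [JointSparsity.size, JointSparsity.theta] using hb) (hbox g hg)
    refine (measureReal_mono ?_ (measure_ne_top _ _)).trans (h.trans_eq ?_)
    · rintro C ⟨f, hf, h⟩
      exact ⟨f, hbox f hf, h⟩
    · simp [errorBound]

theorem JointSparsity.Admissible.pos {σ : JointSparsity} (hσ : σ.Admissible n T) :
    0 < n * T := by
  cases σ with
  | overall k => exact hσ.1.trans hσ.2
  | structured kt ks => exact Nat.mul_pos (hσ.2.1.trans hσ.2.2) (hσ.1.1.trans hσ.1.2)

theorem JointSparsity.Admissible.one_mem_indexSet {σ : JointSparsity} (hσ : σ.Admissible n T) :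
    1 ∈ σ.indexSet := by
  cases σ with
  | overall k => exact Finset.mem_Icc.2 ⟨le_rfl, hσ.1⟩
  | structured kt ks =>
    exact Finset.mem_image₂.2 ⟨1, Finset.mem_Icc.2 ⟨le_rfl, hσ.1.1⟩, 1,
      Finset.mem_Icc.2 ⟨le_rfl, hσ.2.1⟩, rfl⟩

theorem JointSparsity.Admissible.theta_pos {σ : JointSparsity} (hσ : σ.Admissible n T) :
    0 < σ.theta n T := by
  cases σ with
  | overall k => exact Nat.choose_pos hσ.2
  | structured kt ks => exact Nat.mul_pos (Nat.choose_pos hσ.2.2) (Nat.choose_pos hσ.1.2)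

/-- Only `u = 1` is needed, and the factor `l` is dropped: for bounded `k` the choice of word
numbers costs only a constant. -/
theorem logb_theta_le_of_rateThreshold_le {σ : JointSparsity} (hσ : σ.Admissible n T) (hl : 1 ≤ l)
    {ε : ℝ} (hε : 0 < ε) (hR : rateThreshold ε l n T σ ≤ rate n T b) :
    (1 + ε) * σ.size * Real.logb 2 (σ.theta n T) ≤ b := by
  have hnT : (0 : ℝ) < (n : ℝ) * T := by exact_mod_cast hσ.pos
  have h1 : (1 + ε) * (σ.size : ℝ) / (((1 : ℕ) : ℝ) * ((n : ℝ) * (T : ℝ))) *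
      Real.logb 2 ((σ.theta n T : ℝ) * (l : ℝ) ^ 1) ≤ rateThreshold ε l n T σ :=
    le_ciSup (f := fun u : σ.indexSet => (1 + ε) * (σ.size : ℝ) /
      ((u : ℕ) * ((n : ℝ) * (T : ℝ))) * Real.logb 2 ((σ.theta n T : ℝ) * (l : ℝ) ^ (u : ℕ)))
      (Set.finite_range _).bddAbove ⟨1, hσ.one_mem_indexSet⟩
  have h2 := h1.trans hR
  unfold rate at h2
  rw [Nat.cast_one, one_mul, div_mul_eq_mul_div, div_le_div_iff_of_pos_right hnT, pow_one] at h2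
  refine le_trans ?_ h2
  have hθ : (0 : ℝ) < σ.theta n T := by exact_mod_cast hσ.theta_pos
  have hl' : (1 : ℝ) ≤ l := by exact_mod_cast hl
  refine mul_le_mul_of_nonneg_left ?_ (by positivity)
  exact Real.logb_le_logb_of_le (by norm_num) hθ (le_mul_of_one_le_right hθ.le hl')

end Decoder

/-! ### Performance -/

/-- Fubini: given the signals, the event has probability at most `r` over the codebook, while `G` is
constant. -/
theorem integral_indicator_fst_le {Ω Γ : Type*} [MeasurableSpace Ω] [MeasurableSpace Γ]
    {P : Measure Ω} [IsProbabilityMeasure P] {μ : Measure Γ} [IsProbabilityMeasure μ]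
    {S : Set (Ω × Γ)} (hS : MeasurableSet S) {r : ℝ}
    (hr : ∀ᵐ ω ∂P, μ.real (Prod.mk ω ⁻¹' S) ≤ r) {G : Ω → ℝ} (hG0 : ∀ ω, 0 ≤ G ω)
    (hG : Integrable G P) :
    ∫ z, S.indicator (fun z => G z.1) z ∂(P.prod μ) ≤ r * ∫ ω, G ω ∂P := by
  have hint : Integrable (S.indicator fun z => G z.1) (P.prod μ) := (hG.comp_fst μ).indicator hS
  have hsec : ∀ ω, ∫ C, S.indicator (fun z => G z.1) (ω, C) ∂μ =
      μ.real (Prod.mk ω ⁻¹' S) * G ω := by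
    intro ω
    have : (fun C => S.indicator (fun z => G z.1) (ω, C)) =
        (Prod.mk ω ⁻¹' S).indicator fun _ => G ω := by
      funext C
      by_cases h : (ω, C) ∈ S
      · rw [Set.indicator_of_mem h, Set.indicator_of_mem (Set.mem_preimage.2 h)]
      · rw [Set.indicator_of_notMem h, Set.indicator_of_notMem (Set.mem_preimage.not.2 h)]
    rw [this, integral_indicator_const _ (measurable_prodMk_left hS), smul_eq_mul]
  rw [integral_prod _ hint, ← integral_const_mul]
  refine integral_mono_ae hint.integral_prod_left (hG.const_mul r) ?_
  filter_upwards [hr] with ω hω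
  change ∫ C, S.indicator (fun z => G z.1) (ω, C) ∂μ ≤ r * G ω
  rw [hsec]
  exact mul_le_mul_of_nonneg_right hω (hG0 ω)

section System

variable {Ω : Type*} [MeasurableSpace Ω] {P : Measure Ω} {n T l b : ℕ}
  {s : Ω → Fin n → Fin T → ℝ} {Q : ScalarQuantizer l} {N : RelayNetwork n} {k : ℕ}
  {dec : Codebook n T l b → Word b → Selection n T l}

/-- The event that some estimated index is wrong. -/
def wrongIndex (Q : ScalarQuantizer l) (dec : Codebook n T l b → Word b → Selection n T l)
    (s : Ω → Fin n → Fin T → ℝ) : Set (Ω × Codebook n T l b) :=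
  {z | decoded dec z.2 (indices Q (s z.1)) ≠ indices Q (s z.1)}

theorem measurable_indices (hs : ∀ m i, Measurable fun ω => s ω m i) :
    Measurable fun ω => indices Q (s ω) :=
  measurable_pi_lambda _ fun e => Q.measurable_index.comp (hs e.1 e.2)

theorem measurable_indices_prod (hs : ∀ m i, Measurable fun ω => s ω m i) :
    Measurable fun z : Ω × Codebook n T l b => (indices Q (s z.1), z.2) :=
  ((measurable_indices hs).comp measurable_fst).prodMk measurable_snd

theorem measurableSet_wrongIndex (hs : ∀ m i, Measurable fun ω => s ω m i) :
    MeasurableSet (wrongIndex Q dec s) :=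
  -- The event depends only on the indices and the codebook, which range over a finite space, so an
  -- arbitrary `dec` is allowed.
  measurable_indices_prod hs (Set.toFinite
    {y : (Fin n × Fin T → Fin (l + 1)) × Codebook n T l b | decoded dec y.2 y.1 ≠ y.1}).measurableSet

theorem measurable_output (hs : ∀ m i, Measurable fun ω => s ω m i) (m : Fin n) (i : Fin T) :
    Measurable fun z : Ω × Codebook n T l b => output Q N dec z.2 (s z.1) m i := by
  simp only [output_eq]
  exact (measurable_of_finite fun y : (Fin n × Fin T → Fin (l + 1)) × Codebook n T l b =>
    Q.level (decoded dec y.2 y.1 (m, i))).comp (measurable_indices_prod hs)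

theorem ae_codebookLaw_real_decoded_ne_le {σ : JointSparsity} (hσ : σ.Admissible n T) {K : ℕ}
    {ε : ℝ} (hε : 0 < ε) (hK : σ.size ≤ K) (hε1 : σ.size = 1 → 6 / 5 ≤ ε)
    (hb : (1 + ε) * σ.size * Real.logb 2 (σ.theta n T) ≤ b)
    (hsparse : ∀ᵐ ω ∂P, σ.IsSparse (s ω)) {J : Set (Fin (l + 1))}
    (hJ : J = Set.univ ∨ J = {0}ᶜ ∧ ∀ᵐ ω ∂P, ∃ X ∈ σ.supports n T,
      ∀ m i, (m, i) ∈ X ↔ Q.index (s ω m i) ≠ 0)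
    (hdec : IsMLDecoder σ J dec) :
    ∀ᵐ ω ∂P, (codebookLaw n T l b σ.size).real
      {C | decoded dec C (indices Q (s ω)) ≠ indices Q (s ω)} ≤ errorBound l K ε (n * T) := by
  have hsel : ∀ᵐ ω ∂P, ∃ X ∈ σ.supports n T, active (indices Q (s ω)) ⊆ X ∧
      ∀ e ∈ X, indices Q (s ω) e ∈ J := by
    rcases hJ with rfl | ⟨rfl, hJ⟩
    · filter_upwards [hsparse] with ω hω
      obtain ⟨X, hX, h⟩ := feasible_indices hσ Q hω
      exact ⟨X, hX, h, fun _ _ => Set.mem_univ _⟩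
    · filter_upwards [hJ] with ω ⟨X, hX, h⟩
      exact ⟨X, hX, fun e he => (h e.1 e.2).2 (mem_active.1 he), fun e he => (h e.1 e.2).1 he⟩
  filter_upwards [hsel] with ω ⟨X, hX, hsub, hXJ⟩
  refine (measureReal_mono (fun C hC => ?_) (measure_ne_top _ _)).trans
    (codebookLaw_real_ambiguous_le hσ hε hK hε1 hb ⟨X, hX, hsub⟩)
  exact ⟨_, feasible_decoded hdec C _, hC, orWord_decoded hdec C hX hsub hXJ⟩

variable [IsProbabilityMeasure P]

theorem errorProb_le (hs : ∀ m i, Measurable fun ω => s ω m i) {r : ℝ}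
    (hr : ∀ᵐ ω ∂P, (codebookLaw n T l b k).real
      {C | decoded dec C (indices Q (s ω)) ≠ indices Q (s ω)} ≤ r) :
    errorProb P k Q N dec s ≤ r := by
  have hS : MeasurableSet (wrongIndex Q dec s) := measurableSet_wrongIndex hs
  have h := integral_indicator_fst_le (P := P) (μ := codebookLaw n T l b k) hS hr
    (G := fun _ => 1) (fun _ => zero_le_one) (integrable_const 1)
  rw [integral_indicator_const (1 : ℝ) hS] at h
  simp only [smul_eq_mul, mul_one, integral_const, probReal_univ] at h
  refine (measureReal_mono ?_ (measure_ne_top _ _)).trans h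
  rintro ⟨ω, C⟩ ⟨m, i, hmi⟩ heq
  refine hmi ?_
  rw [output_eq]
  dsimp only at heq ⊢
  rw [heq]
  rfl

/-- Off the two active sets, at most `2 k` bins in all, both reconstructions equal `q_0`. On them
the difference factors as `(q - p) (2 y - p - q)`, and `2 |y| ≤ 1 + y ^ 2` brings in the energy. -/
theorem abs_sum_sub_le {L : ℝ} (hL : ∀ j, |Q.level j| ≤ L) (x : Fin n → Fin T → ℝ)
    {f : Fin n × Fin T → Fin (l + 1)} (hf : (active f).card ≤ k)
    (hx : (active (indices Q x)).card ≤ k) :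
    |∑ i, ∑ m, ((x m i - Q.level (f (m, i))) ^ 2 - (x m i - Q.quantize (x m i)) ^ 2)| ≤
      2 * L * (2 * k * (1 + 2 * L) + ∑ i, ∑ m, x m i ^ 2) := by
  have hL0 : 0 ≤ L := (abs_nonneg _).trans (hL 0)
  set D := active f ∪ active (indices Q x) with hD
  have hDk : (D.card : ℝ) ≤ 2 * k := by
    have h1 := Finset.card_union_le (active f) (active (indices Q x))
    have h2 : D.card ≤ 2 * k := by rw [hD]; omega
    exact_mod_cast h2
  have hterm : ∀ m i, |(x m i - Q.level (f (m, i))) ^ 2 - (x m i - Q.quantize (x m i)) ^ 2| ≤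
      2 * L * ((if (m, i) ∈ D then 1 + 2 * L else 0) + x m i ^ 2) := by
    intro m i
    split_ifs with h
    · have h1 := hL (f (m, i))
      have h2 : |Q.quantize (x m i)| ≤ L := hL _
      set y := x m i
      set p := Q.level (f (m, i))
      set q := Q.quantize y
      have e : (y - p) ^ 2 - (y - q) ^ 2 = (q - p) * (2 * y - p - q) := by ring
      rw [e, abs_mul]
      have h3 : |q - p| ≤ 2 * L := (abs_sub _ _).trans (by linarith)
      have h4 : |2 * y - p - q| ≤ 1 + 2 * L + y ^ 2 := by
        rw [abs_le] at h1 h2 ⊢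
        constructor <;> nlinarith [sq_nonneg (y - 1), sq_nonneg (y + 1)]
      exact mul_le_mul h3 h4 (abs_nonneg _) (by linarith)
    · rw [hD, Finset.mem_union, mem_active, mem_active, not_or, not_not, not_not] at h
      have h2 : Q.quantize (x m i) = Q.level (f (m, i)) := by
        rw [h.1]
        exact congrArg Q.level h.2
      rw [h2, sub_self, abs_zero]
      positivity
  calc _ ≤ ∑ i, ∑ m, |(x m i - Q.level (f (m, i))) ^ 2 - (x m i - Q.quantize (x m i)) ^ 2| :=
        (Finset.abs_sum_le_sum_abs _ _).trans
          (Finset.sum_le_sum fun i _ => Finset.abs_sum_le_sum_abs _ _)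
    _ ≤ ∑ i, ∑ m, 2 * L * ((if (m, i) ∈ D then 1 + 2 * L else 0) + x m i ^ 2) :=
        Finset.sum_le_sum fun i _ => Finset.sum_le_sum fun m _ => hterm m i
    _ = 2 * L * (D.card * (1 + 2 * L) + ∑ i, ∑ m, x m i ^ 2) := by
        simp only [← Finset.mul_sum, Finset.sum_add_distrib]
        congr 2
        rw [Finset.sum_comm, ← Fintype.sum_prod_type
          (f := fun e : Fin n × Fin T => if e ∈ D then 1 + 2 * L else 0), Finset.sum_ite_mem,
          Finset.univ_inter, Finset.sum_const, nsmul_eq_mul]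
    _ ≤ _ := by gcongr

theorem abs_mse_sub_quantizerMSE_le (hs : ∀ m i, Measurable fun ω => s ω m i)
    (hs2 : ∀ m i, MemLp (fun ω => s ω m i) 2 P) {L : ℝ} (hL : ∀ j, |Q.level j| ≤ L) {r : ℝ}
    (hdec : ∀ C g, (active (decoded dec C g)).card ≤ k)
    (hk : ∀ᵐ ω ∂P, (active (indices Q (s ω))).card ≤ k)
    (hr : ∀ᵐ ω ∂P, (codebookLaw n T l b k).real
      {C | decoded dec C (indices Q (s ω)) ≠ indices Q (s ω)} ≤ r) :
    |mse P k Q N dec s - quantizerMSE P Q s| ≤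
      r * (2 * L * (2 * k * (1 + 2 * L) + energy P s)) := by
  have hL0 : 0 ≤ L := (abs_nonneg _).trans (hL 0)
  set μ := codebookLaw n T l b k with hμ
  have hsf : ∀ m i, MemLp (fun z : Ω × Codebook n T l b => s z.1 m i) 2 (P.prod μ) :=
    fun m i => (hs2 m i).comp_fst μ
  have hI1 : ∀ m i, Integrable (fun z : Ω × Codebook n T l b =>
      (s z.1 m i - output Q N dec z.2 (s z.1) m i) ^ 2) (P.prod μ) := by
    intro m i
    refine ((hsf m i).sub (MemLp.of_bound (measurable_output hs m i).aestronglyMeasurable L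
      (ae_of_all _ fun z => ?_))).integrable_sq
    rw [output_eq, Real.norm_eq_abs]
    exact hL _
  have hI2 : ∀ m i, Integrable (fun z : Ω × Codebook n T l b =>
      (s z.1 m i - Q.quantize (s z.1 m i)) ^ 2) (P.prod μ) := by
    intro m i
    refine ((hsf m i).sub (MemLp.of_bound (C := L) ?_
      (ae_of_all _ fun z => ?_))).integrable_sq
    · exact ((measurable_of_finite Q.level).comp
        (Q.measurable_index.comp ((hs m i).comp measurable_fst))).aestronglyMeasurable
    · rw [Real.norm_eq_abs]
      exact hL _
  have hq : quantizerMSE P Q s = ∑ i, ∑ m, ∫ z : Ω × Codebook n T l b,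
      (s z.1 m i - Q.quantize (s z.1 m i)) ^ 2 ∂(P.prod μ) := by
    unfold quantizerMSE
    refine Finset.sum_congr rfl fun i _ => Finset.sum_congr rfl fun m _ => ?_
    rw [integral_fun_fst fun ω => (s ω m i - Q.quantize (s ω m i)) ^ 2]
    simp
  have hI : ∀ m i, Integrable (fun z : Ω × Codebook n T l b =>
      (s z.1 m i - output Q N dec z.2 (s z.1) m i) ^ 2
        - (s z.1 m i - Q.quantize (s z.1 m i)) ^ 2) (P.prod μ) :=
    fun m i => (hI1 m i).sub (hI2 m i)
  have hdiff : mse P k Q N dec s - quantizerMSE P Q s = ∫ z : Ω × Codebook n T l b,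
      ∑ i, ∑ m, ((s z.1 m i - output Q N dec z.2 (s z.1) m i) ^ 2
        - (s z.1 m i - Q.quantize (s z.1 m i)) ^ 2) ∂(P.prod μ) := by
    rw [hq, mse, ← Finset.sum_sub_distrib, integral_finsetSum _ fun i _ =>
      integrable_finsetSum _ fun m _ => hI m i]
    refine Finset.sum_congr rfl fun i _ => ?_
    rw [← Finset.sum_sub_distrib, integral_finsetSum _ fun m _ => hI m i]
    exact Finset.sum_congr rfl fun m _ => (integral_sub (hI1 m i) (hI2 m i)).symm
  -- A bound for the loss difference that does not involve the codebook, as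
  -- `integral_indicator_fst_le` demands.
  set G : Ω → ℝ := fun ω => 2 * L * (2 * k * (1 + 2 * L) + ∑ i, ∑ m, s ω m i ^ 2) with hGdef
  have hsq : Integrable (fun ω => ∑ i, ∑ m, s ω m i ^ 2) P :=
    integrable_finsetSum _ fun i _ => integrable_finsetSum _ fun m _ => (hs2 m i).integrable_sq
  have hG : Integrable G P := ((integrable_const _).add hsq).const_mul _
  have hG0 : ∀ ω, 0 ≤ G ω := fun ω => by positivity
  have hGint : ∫ ω, G ω ∂P = 2 * L * (2 * k * (1 + 2 * L) + energy P s) := by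
    rw [hGdef, integral_const_mul, integral_add (integrable_const _) hsq, integral_const,
      integral_finsetSum _ fun i _ => integrable_finsetSum _ fun m _ => (hs2 m i).integrable_sq]
    simp only [probReal_univ, one_smul]
    congr 2
    exact Finset.sum_congr rfl fun i _ =>
      integral_finsetSum _ fun m _ => (hs2 m i).integrable_sq
  have hS : MeasurableSet (wrongIndex Q dec s) := measurableSet_wrongIndex hs
  rw [hdiff, ← hGint, ← Real.norm_eq_abs]
  refine (norm_integral_le_of_norm_le ((hG.comp_fst μ).indicator hS) ?_).trans
    (integral_indicator_fst_le hS hr hG0 hG)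
  have hk' : ∀ᵐ z ∂(P.prod μ), (active (indices Q (s z.1))).card ≤ k :=
    Measure.quasiMeasurePreserving_fst.ae hk
  filter_upwards [hk'] with z hz
  rw [Real.norm_eq_abs]
  by_cases hzS : z ∈ wrongIndex Q dec s
  · rw [Set.indicator_of_mem hzS]
    simp only [output_eq]
    exact abs_sum_sub_le hL (s z.1) (hdec _ _) hz
  · rw [Set.indicator_of_notMem hzS]
    have heq : decoded dec z.2 (indices Q (s z.1)) = indices Q (s z.1) := not_not.1 hzS
    simp only [output_eq, heq]
    simp [indices, ScalarQuantizer.quantize]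

end System

end SQuaTS

/-! ### Passage to the limit -/

theorem proposition2
    -- the scalar quantizer with `l + 1` levels, and `ε`
    (l : ℕ) (hl : 1 ≤ l) (Q : SQuaTS.ScalarQuantizer l) (ε : ℝ) (hε : 0 < ε)
    -- `n` sequences of length `T`, with `n T → ∞` and joint support size `k = O(1)`
    (n T : ℕ → ℕ) (σ : ℕ → SQuaTS.JointSparsity)
    (hσ : ∀ ν, (σ ν).Admissible (n ν) (T ν))
    (hnT : Tendsto (fun ν => n ν * T ν) atTop atTop)
    (hk : (fun ν => ((σ ν).size : ℝ)) =O[atTop] fun _ => (1 : ℝ))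
    -- the rate condition
    (b : ℕ → ℕ)
    (hR : ∀ ν, SQuaTS.rate (n ν) (T ν) (b ν) ≥ SQuaTS.rateThreshold ε l (n ν) (T ν) (σ ν))
    (hk1 : ∀ ν, (σ ν).size = 1 → 1 / (Real.log 2 * Real.logb 2 (1 / Real.log 2)) - 1 < ε)
    -- the random signals
    {Ω : ℕ → Type*} [∀ ν, MeasurableSpace (Ω ν)] (P : ∀ ν, Measure (Ω ν))
    [∀ ν, IsProbabilityMeasure (P ν)] (s : ∀ ν, Ω ν → Fin (n ν) → Fin (T ν) → ℝ)
    (hs : ∀ ν m i, Measurable fun ω => s ν ω m i)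
    (hs2 : ∀ ν m i, MemLp (fun ω => s ν ω m i) 2 (P ν))
    (hsparse : ∀ ν, ∀ᵐ ω ∂(P ν), (σ ν).IsSparse (s ν ω))
    -- the network and the ML decoder; the decoder may select the all-zero word in a bin, and it
    -- may be restricted to the other words if exactly `k` samples have a non-zero index
    (net : ∀ ν, SQuaTS.RelayNetwork (n ν))
    (J : ℕ → Set (Fin (l + 1)))
    (hJ : ∀ ν, J ν = Set.univ ∨ J ν = {0}ᶜ ∧ ∀ᵐ ω ∂(P ν), ∃ X ∈ (σ ν).supports (n ν) (T ν),
      ∀ m i, (m, i) ∈ X ↔ Q.index (s ν ω m i) ≠ 0)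
    (dec : ∀ ν, SQuaTS.Codebook (n ν) (T ν) l (b ν) → SQuaTS.Word (b ν) →
      SQuaTS.Selection (n ν) (T ν) l)
    (hdec : ∀ ν, SQuaTS.IsMLDecoder (σ ν) (J ν) (dec ν)) :
    Tendsto (fun ν => SQuaTS.errorProb (P ν) (σ ν).size Q (net ν) (dec ν) (s ν)) atTop (𝓝 0) ∧
    ((∃ E : ℝ, ∀ ν, SQuaTS.energy (P ν) (s ν) ≤ E) →
      Tendsto (fun ν => SQuaTS.mse (P ν) (σ ν).size Q (net ν) (dec ν) (s ν) -
        SQuaTS.quantizerMSE (P ν) Q (s ν)) atTop (𝓝 0)) := by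
  set L : ℝ := ∑ j, |Q.level j|
  have hL : ∀ j, |Q.level j| ≤ L := fun j =>
    Finset.single_le_sum (f := fun j => |Q.level j|) (fun _ _ => abs_nonneg _) (Finset.mem_univ j)
  have hL0 : 0 ≤ L := (abs_nonneg _).trans (hL 0)
  obtain ⟨c, hc⟩ := hk.bound
  -- A natural bound `K` for the support size, valid only eventually, makes the constant in
  -- `errorBound` independent of `ν`.
  obtain ⟨K, hcK⟩ := exists_nat_ge c
  have hK : ∀ᶠ ν in atTop, (σ ν).size ≤ K := by
    filter_upwards [hc] with ν hν
    rw [norm_one, mul_one, Real.norm_natCast] at hν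
    exact_mod_cast hν.trans hcK
  have hbound := (SQuaTS.tendsto_errorBound l K hε).comp hnT
  have hae : ∀ᶠ ν in atTop, ∀ᵐ ω ∂(P ν),
      (SQuaTS.codebookLaw (n ν) (T ν) l (b ν) (σ ν).size).real
        {C | SQuaTS.decoded (dec ν) C (SQuaTS.indices Q (s ν ω)) ≠ SQuaTS.indices Q (s ν ω)} ≤
      SQuaTS.errorBound l K ε (n ν * T ν) := by
    filter_upwards [hK] with ν hν
    exact SQuaTS.ae_codebookLaw_real_decoded_ne_le (hσ ν) hε hν
      (fun h => SQuaTS.lt_of_one_div_log_two_lt (hk1 ν h))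
      (SQuaTS.logb_theta_le_of_rateThreshold_le (hσ ν) hl hε (hR ν)) (hsparse ν) (hJ ν) (hdec ν)
  refine ⟨?_, ?_⟩
  · refine squeeze_zero' (Eventually.of_forall fun ν => measureReal_nonneg) ?_ hbound
    filter_upwards [hae] with ν hν
    exact SQuaTS.errorProb_le (hs ν) hν
  · rintro ⟨E, hE⟩
    have hbound' := hbound.mul_const (2 * L * (2 * K * (1 + 2 * L) + E))
    rw [zero_mul] at hbound'
    refine squeeze_zero_norm' ?_ hbound'
    filter_upwards [hae, hK] with ν hν hKν
    rw [Real.norm_eq_abs]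
    refine (SQuaTS.abs_mse_sub_quantizerMSE_le (hs ν) (hs2 ν) hL
      (fun C g => (SQuaTS.feasible_decoded (hdec ν) C g).card_active_le) ?_ hν).trans ?_
    · filter_upwards [hsparse ν] with ω hω
      exact (SQuaTS.feasible_indices (hσ ν) Q hω).card_active_le
    · refine mul_le_mul_of_nonneg_left ?_ (SQuaTS.errorBound_nonneg _ _ _ _)
      have h1 : ((σ ν).size : ℝ) ≤ K := by exact_mod_cast hKν
      have h2 := hE ν
      gcongr
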